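/- An instance of Budgeted Conflict Free Egalitarian Allocation (BCFEA) consists of a set $V$ of $n$ items, a set $[k]=\{1,\dots,k\}$ of agents, a graph $G$ on $V$ (the conflict graph), a utility function $p_i:2^V\to\mathbb Z_{\ge 0}$ and a cost function $c_i:2^V\to\mathbb Z_{\ge 0}$ for every agent $i\in[k]$, and integers $P,B\ge 0$. The question is whether $V$ can be partitioned into bundles $S_1,\dots,S_k$ (some of which may be empty) such that, for every $i\in[k]$, $S_i$ is an independent set of $G$, $c_i(S_i)\le B$ and $p_i(S_i)\ge P$. **Theorem.** BCFEA can be solved in time $\mathcal O^\star(2^n)$ for all $k\ge 1$, where $\mathcal O^\star$ suppresses factors polynomial in the size of the instance. Precisely, on random access machines with logarithmic cost: 1. There are a program with value oracles and a polynomial $q$ such that, for every instance with $k\ge 1$, the program, given $n,k,P,B$ and the adjacency matrix of $G$ as input and access to an oracle that returns $p_i(S)$ or $c_i(S)$ when queried with $i$ and the characteristic vector of $S\subseteq V$, decides in time at most $2^n\cdot q(N)$ whether the instance is a yes-instance. Here $N$ is $k$ plus the length of the binary encoding of the input plus the largest bit length of a value $p_i(S)$, $c_i(S)$. 2. There are a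 program without oracles and a polynomial $q$ such that, for every instance with $k\ge 1$ in which all functions are additive, $p_i(S)=\sum_{v\in S}p_i(v)$ and $c_i(S)=\sum_{v\in S}c_i(v)$, the program, given $n,k,P,B$, the adjacency matrix of $G$ and the numbers $p_i(v)$, $c_i(v)$ as input, decides in time at most $2^n\cdot q(N)$ whether the instance is a yes-instance. Here $N$ is $k$ plus the length of the binary encoding of the input. In both parts the program and $q$ are the same for all $n$ and $k$. -/

import Mathlib

/-! ### The problem -/

namespace BCFEA

/-- An instance of Budgeted Conflict Free Egalitarian Allocation: `n` items, `k` agents, a conflict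
graph on the items, a utility function and a cost function on sets of items for every agent, a
utility threshold `P` and a budget `B`. -/
structure Instance where
  n : ℕ
  k : ℕ
  graph : SimpleGraph (Fin n)
  utility : Fin k → Finset (Fin n) → ℕ
  cost : Fin k → Finset (Fin n) → ℕ
  P : ℕ
  B : ℕ

/-- `S` splits the items into one (possibly empty) bundle for every agent; every bundle is
conflict-free, within the budget, and worth at least `P` to its agent. -/
structure Instance.IsSolution (I : Instance) (S : Fin I.k → Finset (Fin I.n)) : Prop where
  disjoint : ∀ i j, i ≠ j → Disjoint (S i) (S j)
  cover : ∀ v, ∃ i, v ∈ S i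
  indep : ∀ i, I.graph.IsIndepSet (S i : Set (Fin I.n))
  budget : ∀ i, I.cost i (S i) ≤ I.B
  satisfied : ∀ i, I.P ≤ I.utility i (S i)

/-- The instance is a yes-instance. -/
def Instance.IsYes (I : Instance) : Prop := ∃ S, I.IsSolution S

/-- An instance in which all utility and cost functions are additive, hence given by their values
on the single items. -/
structure AdditiveInstance where
  n : ℕ
  k : ℕ
  graph : SimpleGraph (Fin n)
  utility : Fin k → Fin n → ℕ
  cost : Fin k → Fin n → ℕ
  P : ℕ
  B : ℕ

def AdditiveInstance.toInstance (I : AdditiveInstance) : Instance where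
  n := I.n
  k := I.k
  graph := I.graph
  utility i S := ∑ v ∈ S, I.utility i v
  cost i S := ∑ v ∈ S, I.cost i v
  P := I.P
  B := I.B

/-! ### Encoding of instances -/

/-- The adjacency matrix of a graph as a list of zeros and ones, row by row. -/
noncomputable def adjWords {n : ℕ} (G : SimpleGraph (Fin n)) : List ℕ :=
  open Classical in
  (List.finRange n).flatMap fun u => (List.finRange n).map fun v => if G.Adj u v then 1 else 0

/-- A `k × n` table of numbers as a list, row by row. -/
def tableWords {k n : ℕ} (f : Fin k → Fin n → ℕ) : List ℕ :=
  (List.finRange k).flatMap fun i => (List.finRange n).map fun v => f i v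

/-- The part of an instance that is written out explicitly: `n, k, P, B` and the conflict graph. -/
noncomputable def Instance.words (I : Instance) : List ℕ :=
  [I.n, I.k, I.P, I.B] ++ adjWords I.graph

/-- An additive instance written out in full. -/
noncomputable def AdditiveInstance.words (I : AdditiveInstance) : List ℕ :=
  [I.n, I.k, I.P, I.B] ++ adjWords I.graph ++ tableWords I.utility ++ tableWords I.cost

/-- The length of a list of numbers that are written in binary, with one separator each. -/
def binaryLength (w : List ℕ) : ℕ := (w.map fun x => Nat.size x + 1).sum

/-- The size of an additive instance: the set of the `k` agents and the binary encoding. -/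
noncomputable def AdditiveInstance.size (I : AdditiveInstance) : ℕ :=
  I.k + binaryLength I.words

/-- The size of an instance whose utilities and costs are given by value oracles: the set of the
`k` agents, the binary encoding of the explicit part, and the largest bit length of a utility or
cost value. -/
noncomputable def Instance.size (I : Instance) : ℕ :=
  I.k + binaryLength I.words +
    Finset.univ.sup fun x : Fin I.k × Finset (Fin I.n) =>
      max (Nat.size (I.utility x.1 x.2)) (Nat.size (I.cost x.1 x.2))

/-! ### Random access machines with logarithmic cost -/

/-- The two kinds of value queries. -/
inductive QueryKind
  | utility
  | cost

/-- A value oracle: the answer to a query about the agent with index `i` and the set of items whose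
characteristic vector is the binary expansion of `s`. -/
abbrev Oracle := QueryKind → (i s : ℕ) → ℕ

/-- The oracle that carries no information. -/
def noOracle : Oracle := fun _ _ _ => 0

/-- The set of items whose characteristic vector is the binary expansion of `s`. -/
def setOfMask (n s : ℕ) : Finset (Fin n) := Finset.univ.filter fun v => s.testBit v = true

/-- The value oracle of an instance, with answer `0` for indices that are not agents. -/
def Instance.oracle (I : Instance) : Oracle
  | .utility, i, s => if h : i < I.k then I.utility ⟨i, h⟩ (setOfMask I.n s) else 0
  | .cost, i, s => if h : i < I.k then I.cost ⟨i, h⟩ (setOfMask I.n s) else 0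

/-- The arithmetic operations of the machine. -/
inductive Op
  | add
  | sub
  | mul
  | div

/-- Subtraction is truncated at zero, division rounds down, and `x / 0 = 0`. -/
def Op.eval : Op → ℕ → ℕ → ℕ
  | .add, x, y => x + y
  | .sub, x, y => x - y
  | .mul, x, y => x * y
  | .div, x, y => x / y

/-- Programs of the machine. Numbers such as `r`, `a`, `b` are the names of registers, fixed in
the program text; the memory is addressed indirectly, through the contents of registers. -/
inductive Program
  /-- do nothing -/
  | skip
  /-- `r := c` -/
  | const (r c : ℕ)
  /-- `r := a ∘ b` -/
  | arith (o : Op) (r a b : ℕ)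
  /-- `r := mem[a]` -/
  | load (r a : ℕ)
  /-- `mem[a] := b` -/
  | store (a b : ℕ)
  /-- `r :=` the oracle's answer for the agent in `a` and the set in `b` -/
  | query (q : QueryKind) (r a b : ℕ)
  /-- first one, then the other -/
  | seq (p₁ p₂ : Program)
  /-- `if r ≠ 0 then p₁ else p₂` -/
  | ite (r : ℕ) (p₁ p₂ : Program)
  /-- `while r ≠ 0 do p` -/
  | loop (r : ℕ) (p : Program)

/-- The contents of the registers and of the memory. -/
structure State where
  reg : ℕ → ℕ
  mem : ℕ → ℕ

def State.setReg (σ : State) (r x : ℕ) : State := { σ with reg := Function.update σ.reg r x }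

def State.setMem (σ : State) (a x : ℕ) : State := { σ with mem := Function.update σ.mem a x }

/-- The initial state: all registers are `0`, the memory holds the input and then zeros. -/
def State.init (w : List ℕ) : State where
  reg := fun _ => 0
  mem := fun a => w.getD a 0

/-- `Exec O p σ τ t`: started in `σ` with the oracle `O`, the program `p` halts in `τ` after time
`t`. Every elementary operation takes time one plus the bit lengths of all the numbers and memory
addresses that it handles. -/
inductive Exec (O : Oracle) : Program → State → State → ℕ → Prop
  | skip (σ : State) : Exec O .skip σ σ 1
  | const (σ : State) (r c : ℕ) :
      Exec O (.const r c) σ (σ.setReg r c) (1 + Nat.size c)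
  | arith (σ : State) (o : Op) (r a b : ℕ) :
      Exec O (.arith o r a b) σ (σ.setReg r (o.eval (σ.reg a) (σ.reg b)))
        (1 + Nat.size (σ.reg a) + Nat.size (σ.reg b))
  | load (σ : State) (r a : ℕ) :
      Exec O (.load r a) σ (σ.setReg r (σ.mem (σ.reg a)))
        (1 + Nat.size (σ.reg a) + Nat.size (σ.mem (σ.reg a)))
  | store (σ : State) (a b : ℕ) :
      Exec O (.store a b) σ (σ.setMem (σ.reg a) (σ.reg b))
        (1 + Nat.size (σ.reg a) + Nat.size (σ.reg b))
  | query (σ : State) (q : QueryKind) (r a b : ℕ) :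
      Exec O (.query q r a b) σ (σ.setReg r (O q (σ.reg a) (σ.reg b)))
        (1 + Nat.size (σ.reg a) + Nat.size (σ.reg b) + Nat.size (O q (σ.reg a) (σ.reg b)))
  | seq {p₁ p₂ : Program} {σ τ υ : State} {s t : ℕ} :
      Exec O p₁ σ τ s → Exec O p₂ τ υ t → Exec O (.seq p₁ p₂) σ υ (s + t)
  | iteTrue {r : ℕ} {p₁ p₂ : Program} {σ τ : State} {t : ℕ} :
      σ.reg r ≠ 0 → Exec O p₁ σ τ t → Exec O (.ite r p₁ p₂) σ τ (1 + Nat.size (σ.reg r) + t)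
  | iteFalse {r : ℕ} {p₁ p₂ : Program} {σ τ : State} {t : ℕ} :
      σ.reg r = 0 → Exec O p₂ σ τ t → Exec O (.ite r p₁ p₂) σ τ (1 + Nat.size (σ.reg r) + t)
  | loopExit {r : ℕ} {p : Program} {σ : State} :
      σ.reg r = 0 → Exec O (.loop r p) σ σ (1 + Nat.size (σ.reg r))
  | loopNext {r : ℕ} {p : Program} {σ τ υ : State} {s t : ℕ} :
      σ.reg r ≠ 0 → Exec O p σ τ s → Exec O (.loop r p) τ υ t →
        Exec O (.loop r p) σ υ (1 + Nat.size (σ.reg r) + s + t)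

/-- The machine is deterministic: final state and running time are determined by the start. -/
theorem Exec.deterministic {O : Oracle} {p : Program} {σ τ τ' : State} {t t' : ℕ}
    (h : Exec O p σ τ t) (h' : Exec O p σ τ' t') : τ = τ' ∧ t = t' := by
  induction h generalizing τ' t' with
  | seq _ _ ih₁ ih₂ =>
    cases h' with
    | seq a b =>
      obtain ⟨rfl, rfl⟩ := ih₁ a
      obtain ⟨rfl, rfl⟩ := ih₂ b
      exact ⟨rfl, rfl⟩
  | iteTrue hr _ ih =>
    cases h' with
    | iteTrue _ a => obtain ⟨rfl, rfl⟩ := ih a; exact ⟨rfl, rfl⟩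
    | iteFalse h0 _ => exact absurd h0 hr
  | iteFalse hr _ ih =>
    cases h' with
    | iteTrue h0 _ => exact absurd hr h0
    | iteFalse _ a => obtain ⟨rfl, rfl⟩ := ih a; exact ⟨rfl, rfl⟩
  | loopExit hr =>
    cases h' with
    | loopExit _ => exact ⟨rfl, rfl⟩
    | loopNext h0 _ _ => exact absurd hr h0
  | loopNext hr _ _ ih₁ ih₂ =>
    cases h' with
    | loopExit h0 => exact absurd h0 hr
    | loopNext _ a b =>
      obtain ⟨rfl, rfl⟩ := ih₁ a
      obtain ⟨rfl, rfl⟩ := ih₂ b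
      exact ⟨rfl, rfl⟩
  | _ => cases h'; exact ⟨rfl, rfl⟩

/-- On the input `w` and with the oracle `O`, the program `p` halts within time `T` and leaves the
truth value of `answer` in register `0`, as `1` or `0`. -/
def Decides (p : Program) (O : Oracle) (w : List ℕ) (answer : Prop) (T : ℕ) : Prop :=
  ∃ (τ : State) (t : ℕ), Exec O p (State.init w) τ t ∧ t ≤ T ∧
    (answer → τ.reg 0 = 1) ∧ (¬ answer → τ.reg 0 = 0)

end BCFEA

/-! ### Program logic -/

namespace BCFEA

/-! A partition of the items is the same as a cover by bundles whose sizes add up to `n`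
(`disjoint_of_sum_card_le`, `Instance.isYes_iff`). Covers are easier to count than partitions. Give
a bundle `Y` that agent `i` accepts the weight `M ^ |Y|`, and every other bundle the weight `0`. The
fast zeta transform sums these weights over all subsets of each set `s`. Multiplying the sums of all
agents gives the sum, over all tuples of subsets of `s`, of the products of the weights. Grouped by
the union of the tuple, this is again a zeta transform, so Möbius inversion at the full set leaves
exactly the tuples that cover all items (`moebiusPasses_prod`).

Each such cover by feasible bundles contributes `M` to the power of its total size, which is at
least `n`. Modulo `M ^ (n + 1)` only the feasible partitions survive, and the result is `A * M ^ n`,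
where `A` is their number. With `M = 2 ^ (n * k + 1)` there are fewer than `M` tuples altogether, so
the residue is zero exactly when `A = 0` (`sum_covers_mod_eq_zero_iff`, `result_mod_eq_zero_iff`).
Thus an integer plays the role of the formal variable that would record sizes, and no polynomial
arithmetic is needed.

For the running time, the program keeps two arrays of `2 ^ n` numbers of polynomial bit length and
makes `n` passes for each agent and `n` more for the inversion. `Run` counts steps in units of one
machine word of `W` bits, so the logarithmic cost only enters through the final factor `W + 1`. The
two parts of the theorem share `mainProg`; they differ in the fragment that finds the utility and
the cost of one bundle, specified by `IsValueProg`, and in the expression for the input length. -/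

@[simp] theorem State.setReg_reg (σ : State) (r x r' : ℕ) :
    (σ.setReg r x).reg r' = if r' = r then x else σ.reg r' := by
  simp [State.setReg, Function.update_apply]

@[simp] theorem State.setReg_mem (σ : State) (r x : ℕ) : (σ.setReg r x).mem = σ.mem := rfl

@[simp] theorem State.setMem_mem (σ : State) (a x a' : ℕ) :
    (σ.setMem a x).mem a' = if a' = a then x else σ.mem a' := by
  simp [State.setMem, Function.update_apply]

@[simp] theorem State.setMem_reg (σ : State) (a x : ℕ) : (σ.setMem a x).reg = σ.reg := rfl

theorem size_add_le (x y : ℕ) : Nat.size (x + y) ≤ Nat.size x + Nat.size y := by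
  rcases Nat.eq_zero_or_pos x with rfl | hx
  · simp
  rcases Nat.eq_zero_or_pos y with rfl | hy
  · simp
  have hx' := Nat.size_pos.2 hx
  have hy' := Nat.size_pos.2 hy
  have h1 := Nat.lt_size_self x
  have h2 := Nat.lt_size_self y
  rw [Nat.size_le]
  have h3 : 2 ^ x.size ≤ 2 ^ (x.size + y.size - 1) := Nat.pow_le_pow_right two_pos (by omega)
  have h4 : 2 ^ y.size ≤ 2 ^ (x.size + y.size - 1) := Nat.pow_le_pow_right two_pos (by omega)
  have h5 : 2 ^ (x.size + y.size) = 2 * 2 ^ (x.size + y.size - 1) := by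
    rw [← pow_succ']; congr 1; omega
  omega

theorem size_mul_le (x y : ℕ) : Nat.size (x * y) ≤ Nat.size x + Nat.size y := by
  rw [Nat.size_le, pow_add]
  exact Nat.mul_lt_mul'' (Nat.lt_size_self x) (Nat.lt_size_self y)

theorem Op.size_eval_le (o : Op) (x y : ℕ) :
    Nat.size (o.eval x y) ≤ Nat.size x + Nat.size y := by
  cases o
  · exact size_add_le x y
  · exact (Nat.size_le_size (Nat.sub_le x y)).trans (Nat.le_add_right _ _)
  · exact size_mul_le x y
  · exact (Nat.size_le_size (Nat.div_le_self x y)).trans (Nat.le_add_right _ _)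

/-- Arithmetic expressions over registers, memory cells and oracle answers. -/
inductive Expr
  | var (r : ℕ)
  | lit (c : ℕ)
  | op (o : Op) (a b : Expr)
  | mem (a : Expr)
  | ask (q : QueryKind) (a b : Expr)

namespace Expr

instance : Add Expr := ⟨.op .add⟩
instance : Sub Expr := ⟨.op .sub⟩
instance : Mul Expr := ⟨.op .mul⟩
instance : Div Expr := ⟨.op .div⟩
instance (c : ℕ) : OfNat Expr c := ⟨.lit c⟩

/-- The value of an expression. -/
def eval (O : Oracle) (σ : State) : Expr → ℕ
  | var r => σ.reg r
  | lit c => c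
  | op o a b => o.eval (a.eval O σ) (b.eval O σ)
  | mem a => σ.mem (a.eval O σ)
  | ask q a b => O q (a.eval O σ) (b.eval O σ)

section
variable (O : Oracle) (σ : State) (a b : Expr)
@[simp] theorem eval_var (r : ℕ) : (var r).eval O σ = σ.reg r := rfl
@[simp] theorem eval_lit (c : ℕ) : (lit c).eval O σ = c := rfl
@[simp] theorem eval_zero : (0 : Expr).eval O σ = 0 := rfl
@[simp] theorem eval_one : (1 : Expr).eval O σ = 1 := rfl
@[simp] theorem eval_two : (2 : Expr).eval O σ = 2 := rfl
@[simp] theorem eval_four : (4 : Expr).eval O σ = 4 := rfl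
@[simp] theorem eval_add : (a + b).eval O σ = a.eval O σ + b.eval O σ := rfl
@[simp] theorem eval_sub : (a - b).eval O σ = a.eval O σ - b.eval O σ := rfl
@[simp] theorem eval_mul : (a * b).eval O σ = a.eval O σ * b.eval O σ := rfl
@[simp] theorem eval_div : (a / b).eval O σ = a.eval O σ / b.eval O σ := rfl
@[simp] theorem eval_op (o : Op) : (op o a b).eval O σ = o.eval (a.eval O σ) (b.eval O σ) := rfl
@[simp] theorem eval_mem : (mem a).eval O σ = σ.mem (a.eval O σ) := rfl
@[simp] theorem eval_ask (q : QueryKind) :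
    (ask q a b).eval O σ = O q (a.eval O σ) (b.eval O σ) := rfl
end

/-- All registers of the expression are below `32`; the registers from `32` on are reserved for
intermediate results. -/
def Closed : Expr → Bool
  | var r => r < 32
  | lit _ => true
  | op _ a b => a.Closed && b.Closed
  | mem a => a.Closed
  | ask _ a b => a.Closed && b.Closed

/-- The bit length of the value is at most this many machine words. -/
def width : Expr → ℕ
  | var _ => 1
  | lit c => c
  | op _ a b => a.width + b.width
  | mem _ => 1
  | ask _ _ _ => 1

/-- The evaluation takes at most this many times the length of a machine word. -/
def steps : Expr → ℕ
  | var _ => 2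
  | lit c => c + 1
  | op _ a b => a.steps + b.steps + (1 + a.width + b.width)
  | mem a => a.steps + (1 + a.width)
  | ask _ a b => a.steps + b.steps + (1 + a.width + b.width)

section
variable (a b : Expr)
@[simp] theorem width_var (r : ℕ) : (var r).width = 1 := rfl
@[simp] theorem width_one : (1 : Expr).width = 1 := rfl
@[simp] theorem width_two : (2 : Expr).width = 2 := rfl
@[simp] theorem width_four : (4 : Expr).width = 4 := rfl
@[simp] theorem width_add : (a + b).width = a.width + b.width := rfl
@[simp] theorem width_sub : (a - b).width = a.width + b.width := rfl
@[simp] theorem width_mul : (a * b).width = a.width + b.width := rfl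
@[simp] theorem width_div : (a / b).width = a.width + b.width := rfl
@[simp] theorem width_op (o : Op) : (op o a b).width = a.width + b.width := rfl
@[simp] theorem width_mem : (mem a).width = 1 := rfl
@[simp] theorem steps_var (r : ℕ) : (var r).steps = 2 := rfl
@[simp] theorem steps_zero : (0 : Expr).steps = 1 := rfl
@[simp] theorem steps_one : (1 : Expr).steps = 2 := rfl
@[simp] theorem steps_two : (2 : Expr).steps = 3 := rfl
@[simp] theorem steps_four : (4 : Expr).steps = 5 := rfl
@[simp] theorem steps_add : (a + b).steps = a.steps + b.steps + (1 + a.width + b.width) := rfl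
@[simp] theorem steps_sub : (a - b).steps = a.steps + b.steps + (1 + a.width + b.width) := rfl
@[simp] theorem steps_mul : (a * b).steps = a.steps + b.steps + (1 + a.width + b.width) := rfl
@[simp] theorem steps_div : (a / b).steps = a.steps + b.steps + (1 + a.width + b.width) := rfl
@[simp] theorem steps_op (o : Op) :
    (op o a b).steps = a.steps + b.steps + (1 + a.width + b.width) := rfl
@[simp] theorem steps_mem : (mem a).steps = a.steps + (1 + a.width) := rfl
end

/-- A program that evaluates the expression into register `d`, using registers from `d` on. -/
def code : Expr → ℕ → Program
  | var r, d => .seq (.const d 0) (.arith .add d r d)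
  | lit c, d => .const d c
  | op o a b, d => .seq (a.code d) (.seq (b.code (d + 1)) (.arith o d d (d + 1)))
  | mem a, d => .seq (a.code d) (.load d d)
  | ask q a b, d => .seq (a.code d) (.seq (b.code (d + 1)) (.query q d d (d + 1)))

end Expr

/-- All numbers in the state fit into `W` bits. -/
structure Bounded (W : ℕ) (σ : State) : Prop where
  reg : ∀ r, σ.reg r < 2 ^ W
  mem : ∀ a, σ.mem a < 2 ^ W

theorem Bounded.setReg {W : ℕ} {σ : State} (h : Bounded W σ) (r : ℕ) {x : ℕ} (hx : x < 2 ^ W) :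
    Bounded W (σ.setReg r x) where
  reg r' := by
    rw [State.setReg_reg]; split
    · exact hx
    · exact h.reg r'
  mem := h.mem

theorem Bounded.setMem {W : ℕ} {σ : State} (h : Bounded W σ) (a : ℕ) {x : ℕ} (hx : x < 2 ^ W) :
    Bounded W (σ.setMem a x) where
  reg := h.reg
  mem a' := by
    rw [State.setMem_mem]; split
    · exact hx
    · exact h.mem a'

/-- The states agree up to the registers for intermediate results. -/
structure Sim (σ' σ : State) : Prop where
  reg : ∀ r < 32, σ'.reg r = σ.reg r
  mem : σ'.mem = σ.mem

theorem Sim.refl (σ : State) : Sim σ σ := ⟨fun _ _ => rfl, rfl⟩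

theorem Sim.setReg_right {σ' τ' σ : State} {d : ℕ} (h : Sim σ' σ) (hd : 32 ≤ d)
    (hr : ∀ r < d, τ'.reg r = σ'.reg r) (hm : τ'.mem = σ'.mem) : Sim τ' σ :=
  ⟨fun r hr' => (hr r (by omega)).trans (h.reg r hr'), hm.trans h.mem⟩

/-- Only registers, memory cells and oracle answers are assumed to fit into `W` bits. Values of
subexpressions may be longer, but no operation produces more bits than its operands have together,
so the excess is a factor fixed by the program text. -/
theorem Expr.size_eval_le {O : Oracle} {W : ℕ} (hO : ∀ q i s, O q i s < 2 ^ W) {σ : State}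
    (hσ : Bounded W σ) (e : Expr) : Nat.size (e.eval O σ) ≤ e.width * (W + 1) := by
  induction e with
  | var r =>
    have := Nat.size_le.2 (hσ.reg r)
    simp only [eval, width]; omega
  | lit c =>
    have : Nat.size c ≤ c := Nat.size_le.2 Nat.lt_two_pow_self
    simp only [eval, width]; nlinarith
  | op o a b iha ihb =>
    have := o.size_eval_le (a.eval O σ) (b.eval O σ)
    simp only [eval, width, add_mul]; omega
  | mem a =>
    have := Nat.size_le.2 (hσ.mem (a.eval O σ))
    simp only [eval, width]; omega
  | ask q a b =>
    have := Nat.size_le.2 (hO q (a.eval O σ) (b.eval O σ))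
    simp only [eval, width]; omega

/-- Evaluation into `d` leaves all registers below `d` alone. Hence the first operand survives in
`d` while the second one is evaluated into `d + 1`, and the program variables below `32` are never
disturbed. -/
theorem Expr.exec_code {O : Oracle} {W : ℕ} (hO : ∀ q i s, O q i s < 2 ^ W) {σ : State}
    (hσ : Bounded W σ) (e : Expr) (he : e.Closed = true) {d : ℕ} (hd : 32 ≤ d) {σ' : State}
    (hs : Sim σ' σ) :
    ∃ τ' t, Exec O (e.code d) σ' τ' t ∧ t ≤ e.steps * (W + 1) ∧ τ'.reg d = e.eval O σ ∧
      (∀ r < d, τ'.reg r = σ'.reg r) ∧ τ'.mem = σ'.mem := by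
  induction e generalizing d σ' with
  | var r =>
    simp only [Closed, decide_eq_true_eq] at he
    refine ⟨_, _, .seq (.const _ _ _) (.arith _ _ _ _ _), ?_, ?_, ?_, rfl⟩
    · have := Nat.size_le.2 (hσ.reg r)
      have hne : r ≠ d := by omega
      simp [hne, hs.reg r he, steps]
      omega
    · have hne : r ≠ d := by omega
      simp [hne, hs.reg r he, Op.eval]
    · intro r' hr'
      have hne : r' ≠ d := by omega
      simp [hne]
  | lit c =>
    refine ⟨_, _, .const _ _ _, ?_, by simp, ?_, rfl⟩
    · have : Nat.size c ≤ c := Nat.size_le.2 Nat.lt_two_pow_self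
      simp only [steps]; nlinarith
    · intro r' hr'
      have hne : r' ≠ d := by omega
      simp [hne]
  | op o a b iha ihb =>
    simp only [Closed, Bool.and_eq_true] at he
    obtain ⟨τ₁, t₁, h₁, ht₁, hv₁, hr₁, hm₁⟩ := iha he.1 hd hs
    obtain ⟨τ₂, t₂, h₂, ht₂, hv₂, hr₂, hm₂⟩ :=
      ihb he.2 (d := d + 1) (by omega) (hs.setReg_right hd hr₁ hm₁)
    have hv : τ₂.reg d = a.eval O σ := (hr₂ d (by omega)).trans hv₁
    have ha := a.size_eval_le hO hσ
    have hb := b.size_eval_le hO hσ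
    refine ⟨_, _, .seq h₁ (.seq h₂ (.arith _ _ _ _ _)), ?_, ?_, ?_, hm₂.trans hm₁⟩
    · rw [hv, hv₂]; simp only [steps, add_mul]; omega
    · simp [hv, hv₂]
    · intro r' hr'
      have hne : r' ≠ d := by omega
      simp [hne, hr₂ r' (by omega), hr₁ r' hr']
  | mem a iha =>
    obtain ⟨τ₁, t₁, h₁, ht₁, hv₁, hr₁, hm₁⟩ := iha he hd hs
    have ha := a.size_eval_le hO hσ
    have hm := Nat.size_le.2 (hσ.mem (a.eval O σ))
    refine ⟨_, _, .seq h₁ (.load _ _ _), ?_, ?_, ?_, hm₁⟩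
    · rw [hv₁, hm₁, hs.mem]; simp only [steps, add_mul]; omega
    · simp [hv₁, hm₁, hs.mem]
    · intro r' hr'
      have hne : r' ≠ d := by omega
      simp [hne, hr₁ r' hr']
  | ask q a b iha ihb =>
    simp only [Closed, Bool.and_eq_true] at he
    obtain ⟨τ₁, t₁, h₁, ht₁, hv₁, hr₁, hm₁⟩ := iha he.1 hd hs
    obtain ⟨τ₂, t₂, h₂, ht₂, hv₂, hr₂, hm₂⟩ :=
      ihb he.2 (d := d + 1) (by omega) (hs.setReg_right hd hr₁ hm₁)
    have hv : τ₂.reg d = a.eval O σ := (hr₂ d (by omega)).trans hv₁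
    have ha := a.size_eval_le hO hσ
    have hb := b.size_eval_le hO hσ
    have hq := Nat.size_le.2 (hO q (a.eval O σ) (b.eval O σ))
    refine ⟨_, _, .seq h₁ (.seq h₂ (.query _ _ _ _ _)), ?_, ?_, ?_, hm₂.trans hm₁⟩
    · rw [hv, hv₂]; simp only [steps, add_mul]; omega
    · simp [hv, hv₂]
    · intro r' hr'
      have hne : r' ≠ d := by omega
      simp [hne, hr₂ r' (by omega), hr₁ r' hr']

/-- `x := e` -/
def assign (x : ℕ) (e : Expr) : Program :=
  .seq (e.code 32) (.seq (.const 33 0) (.arith .add x 32 33))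

/-- `mem[a] := e` -/
def write (a e : Expr) : Program :=
  .seq (a.code 32) (.seq (e.code 33) (.store 32 33))

/-- `if e ≠ 0 then p₁ else p₂` -/
def cond (e : Expr) (p₁ p₂ : Program) : Program :=
  .seq (e.code 32) (.ite 32 p₁ p₂)

/-- `while e ≠ 0 do p` -/
def loopWhile (e : Expr) (p : Program) : Program :=
  .seq (e.code 32) (.loop 32 (.seq p (e.code 32)))

/-- `for x = 0, 1, …, lim - 1 do p` -/
def forUp (x lim : ℕ) (p : Program) : Program :=
  .seq (assign x 0) (loopWhile (.var lim - .var x) (.seq p (assign x (.var x + 1))))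

/-- Total correctness: started in `σ`, the program halts in a state with the property `Q` after at
most `m * (W + 1)` time units, and all its variables fit into `W` bits between statements. -/
def Run (O : Oracle) (W : ℕ) (p : Program) (σ : State) (m : ℕ) (Q : State → Prop) : Prop :=
  (∀ q i s, O q i s < 2 ^ W) → Bounded W σ → ∀ σ', Sim σ' σ →
    ∃ τ' τ t, Exec O p σ' τ' t ∧ t ≤ m * (W + 1) ∧ Sim τ' τ ∧ Bounded W τ ∧ Q τ

namespace Run

variable {O : Oracle} {W : ℕ} {σ : State} {Q : State → Prop}

/-- Makes the bounds that are built into `Run` available while a `Run` statement is being proved. -/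
theorem intro {p : Program} {m : ℕ} (h : (∀ q i s, O q i s < 2 ^ W) → Bounded W σ →
    Run O W p σ m Q) : Run O W p σ m Q :=
  fun hO hσ => h hO hσ hO hσ

theorem mono {p : Program} {m m' : ℕ} {Q' : State → Prop} (h : Run O W p σ m Q')
    (hm : m ≤ m') (hQ : ∀ τ, Bounded W τ → Q' τ → Q τ) : Run O W p σ m' Q := by
  intro hO hσ σ' hs
  obtain ⟨τ', τ, t, he, ht, hs', hb, hq⟩ := h hO hσ σ' hs
  exact ⟨τ', τ, t, he, ht.trans (Nat.mul_le_mul_right _ hm), hs', hb, hQ τ hb hq⟩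

theorem skip (h : Q σ) : Run O W .skip σ 1 Q := fun _ hσ σ' hs =>
  ⟨σ', σ, 1, .skip _, by omega, hs, hσ, h⟩

theorem seq {p₁ p₂ : Program} {m₁ m₂ : ℕ}
    (h : Run O W p₁ σ m₁ fun τ => Run O W p₂ τ m₂ Q) : Run O W (.seq p₁ p₂) σ (m₁ + m₂) Q := by
  intro hO hσ σ' hs
  obtain ⟨τ', τ, t, he, ht, hs', hb, hq⟩ := h hO hσ σ' hs
  obtain ⟨υ', υ, u, he', hu, hs'', hb', hq'⟩ := hq hO hb τ' hs'
  exact ⟨υ', υ, t + u, .seq he he', by rw [add_mul]; omega, hs'', hb', hq'⟩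

theorem assign {x : ℕ} {e : Expr} (he : e.Closed = true := by decide)
    (hv : Bounded W σ → e.eval O σ < 2 ^ W) (h : Q (σ.setReg x (e.eval O σ))) :
    Run O W (assign x e) σ (e.steps + 2) Q := by
  intro hO hσ σ' hs
  obtain ⟨τ₁, t₁, h₁, ht₁, hv₁, hr₁, hm₁⟩ := e.exec_code hO hσ he le_rfl hs
  refine ⟨_, σ.setReg x (e.eval O σ), _, .seq h₁ (.seq (.const _ _ _) (.arith _ _ _ _ _)),
    ?_, ⟨?_, hm₁.trans hs.mem⟩, hσ.setReg x (hv hσ), h⟩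
  · have := Nat.size_le.2 (hv hσ)
    simp [hv₁, add_mul]; omega
  · intro r hr
    have h33 : r ≠ 33 := by omega
    simp [h33, hv₁, Op.eval, hr₁ r hr, hs.reg r hr]

theorem write {a e : Expr} (ha : a.Closed = true := by decide) (he : e.Closed = true := by decide)
    (hv : Bounded W σ → e.eval O σ < 2 ^ W) (h : Q (σ.setMem (a.eval O σ) (e.eval O σ))) :
    Run O W (write a e) σ (a.steps + e.steps + (a.width + 1)) Q := by
  intro hO hσ σ' hs
  obtain ⟨τ₁, t₁, h₁, ht₁, hv₁, hr₁, hm₁⟩ := a.exec_code hO hσ ha le_rfl hs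
  obtain ⟨τ₂, t₂, h₂, ht₂, hv₂, hr₂, hm₂⟩ :=
    e.exec_code hO hσ he (d := 33) (by omega) (hs.setReg_right le_rfl hr₁ hm₁)
  have hw : τ₂.reg 32 = a.eval O σ := (hr₂ 32 (by omega)).trans hv₁
  refine ⟨_, σ.setMem (a.eval O σ) (e.eval O σ), _, .seq h₁ (.seq h₂ (.store _ _ _)),
    ?_, ⟨?_, ?_⟩, hσ.setMem _ (hv hσ), h⟩
  · have := Nat.size_le.2 (hv hσ)
    have := a.size_eval_le hO hσ
    simp only [hw, hv₂, add_mul]; omega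
  · intro r hr
    simp [hr₂ r (by omega), hr₁ r hr, hs.reg r hr]
  · ext b
    simp [hw, hv₂, hm₂, hm₁, hs.mem]

theorem cond {e : Expr} {p₁ p₂ : Program} {m : ℕ} (he : e.Closed = true := by decide)
    (h₁ : e.eval O σ ≠ 0 → Run O W p₁ σ m Q) (h₂ : e.eval O σ = 0 → Run O W p₂ σ m Q) :
    Run O W (cond e p₁ p₂) σ (e.steps + (e.width + 1) + m) Q := by
  intro hO hσ σ' hs
  obtain ⟨τ₁, t₁, hc, ht₁, hv₁, hr₁, hm₁⟩ := e.exec_code hO hσ he le_rfl hs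
  have hw := e.size_eval_le hO hσ
  have hs₁ := hs.setReg_right le_rfl hr₁ hm₁
  by_cases h0 : e.eval O σ = 0
  · obtain ⟨τ', τ, t, hx, ht, hs', hb, hq⟩ := h₂ h0 hO hσ τ₁ hs₁
    exact ⟨τ', τ, _, .seq hc (.iteFalse (hv₁.trans h0) hx),
      by simp only [hv₁, add_mul]; omega, hs', hb, hq⟩
  · obtain ⟨τ', τ, t, hx, ht, hs', hb, hq⟩ := h₁ h0 hO hσ τ₁ hs₁
    exact ⟨τ', τ, _, .seq hc (.iteTrue (by rwa [hv₁]) hx),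
      by simp only [hv₁, add_mul]; omega, hs', hb, hq⟩

/-- The index of the invariant is the number of iterations still to come, so one family of
predicates serves as invariant and as termination measure. -/
theorem loopWhile {e : Expr} {p : Program} {m : ℕ} {Inv : ℕ → State → Prop}
    (he : e.Closed = true := by decide) (N : ℕ) (h0 : Inv N σ)
    (hpos : ∀ j τ, Inv (j + 1) τ → e.eval O τ ≠ 0 ∧ Run O W p τ m (Inv j))
    (hzero : ∀ τ, Inv 0 τ → e.eval O τ = 0 ∧ Q τ) :
    Run O W (loopWhile e p) σ (e.steps + (e.width + 1) + N * (m + e.steps + (e.width + 1))) Q := by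
  -- The loop tests register `32`, which is scratch space and not covered by `Sim`; that it holds
  -- the current value of the condition is therefore carried through the induction separately.
  have key : ∀ (N : ℕ) (σ : State), Inv N σ → (∀ q i s, O q i s < 2 ^ W) → Bounded W σ →
      ∀ σ', Sim σ' σ → σ'.reg 32 = e.eval O σ →
        ∃ τ' τ t, Exec O (.loop 32 (.seq p (e.code 32))) σ' τ' t ∧
          t ≤ ((e.width + 1) + N * (m + e.steps + (e.width + 1))) * (W + 1) ∧
          Sim τ' τ ∧ Bounded W τ ∧ Q τ := by
    intro N
    induction N with
    | zero =>
      intro σ hI hO hσ σ' hs hv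
      obtain ⟨hz, hq⟩ := hzero σ hI
      refine ⟨σ', σ, _, .loopExit (hv.trans hz), ?_, hs, hσ, hq⟩
      rw [hv, hz]; simp [add_mul]; omega
    | succ N ih =>
      intro σ hI hO hσ σ' hs hv
      obtain ⟨hz, hr⟩ := hpos N σ hI
      obtain ⟨τ', τ, t, hx, ht, hs', hb, hI'⟩ := hr hO hσ σ' hs
      obtain ⟨τ₁, t₁, hc, ht₁, hv₁, hr₁, hm₁⟩ := e.exec_code hO hb he le_rfl hs'
      obtain ⟨υ', υ, u, hl, hu, hsu, hbu, hq⟩ :=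
        ih τ hI' hO hb τ₁ (hs'.setReg_right le_rfl hr₁ hm₁) hv₁
      refine ⟨υ', υ, _, .loopNext (by rwa [hv]) (.seq hx hc) hl, ?_, hsu, hbu, hq⟩
      have hw := e.size_eval_le hO hσ
      rw [hv]
      calc 1 + (e.eval O σ).size + (t + t₁) + u
          ≤ (1 * (W + 1) + e.width * (W + 1)) + (m * (W + 1) + e.steps * (W + 1)) +
            ((e.width + 1) + N * (m + e.steps + (e.width + 1))) * (W + 1) := by gcongr; omega
        _ = _ := by ring
  intro hO hσ σ' hs
  obtain ⟨τ₁, t₁, hc, ht₁, hv₁, hr₁, hm₁⟩ := e.exec_code hO hσ he le_rfl hs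
  obtain ⟨υ', υ, u, hl, hu, hsu, hbu, hq⟩ :=
    key N σ h0 hO hσ τ₁ (hs.setReg_right le_rfl hr₁ hm₁) hv₁
  refine ⟨υ', υ, _, .seq hc hl, ?_, hsu, hbu, hq⟩
  rw [add_assoc, add_mul]
  omega

/-- The invariant is required after the counter has been advanced, since it may mention the counter.
The body has to preserve both the counter and the limit. -/
theorem forUp {x lim : ℕ} {p : Program} {m N : ℕ} (Inv : ℕ → State → Prop) (hx : x < 32)
    (hl : lim < 32) (hne : lim ≠ x) (hN : σ.reg lim = N) (h0 : Inv 0 (σ.setReg x 0))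
    (hstep : ∀ j τ, j < N → Inv j τ → τ.reg x = j → τ.reg lim = N →
      Run O W p τ m fun τ' => τ'.reg x = j ∧ τ'.reg lim = N ∧ Inv (j + 1) (τ'.setReg x (j + 1)))
    (hQ : ∀ τ, Inv N τ → τ.reg x = N → τ.reg lim = N → Q τ) :
    Run O W (forUp x lim p) σ (N * (m + 22) + 15) Q := by
  refine intro fun hO hσ => ?_
  have hNW : N < 2 ^ W := hN ▸ hσ.reg lim
  let e : Expr := .var lim - .var x
  have he : e.Closed = true := by
    change (decide (lim < 32) && decide (x < 32)) = true; simp [hx, hl]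
  have hw : e.width = 2 := rfl
  have hs : e.steps = 7 := rfl
  have hs1 : (Expr.var x + 1).steps = 7 := rfl
  have hc1 : (Expr.var x + 1).Closed = true := by
    change (decide (x < 32) && true) = true; simp [hx]
  have h1 := seq (O := O) (W := W) (σ := σ) (Q := Q) (p₁ := BCFEA.assign x 0)
    (m₁ := 3)
    (assign rfl (fun _ => by simp) (loopWhile (e := e)
    (p := .seq p (BCFEA.assign x (.var x + 1))) (m := m + 9)
    (Inv := fun l τ => ∃ j, j + l = N ∧ Inv j τ ∧ τ.reg x = j ∧ τ.reg lim = N) he N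
    ⟨0, by simp, by simpa using h0, by simp, by simp [hne, hN]⟩ ?_ ?_))
  · refine h1.mono ?_ fun _ _ h => h
    rw [hw, hs]; ring_nf; omega
  · rintro l τ ⟨j, hj, hI, hjx, hjl⟩
    refine ⟨by simp [e, hjx, hjl]; omega, seq ?_⟩
    refine (hstep j τ (by omega) hI hjx hjl).mono le_rfl fun τ' _ ⟨h1, h2, h3⟩ => ?_
    have hv : (Expr.var x + 1).eval O τ' = j + 1 := by simp [h1]
    refine assign hc1 (fun _ => by rw [hv]; omega)
      ⟨j + 1, by omega, by rw [hv]; exact h3, by simp [h1], by simp [hne, h2]⟩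
  · rintro τ ⟨j, hj, hI, hjx, hjl⟩
    obtain rfl : j = N := by omega
    exact ⟨by simp [e, hjx, hjl], hQ τ hI hjx hjl⟩

end Run

end BCFEA

/-! ### Auxiliary program fragments -/

namespace BCFEA

/-- Only the registers in `L` have changed. -/
def Frame (L : List ℕ) (σ τ : State) : Prop := ∀ r, r ∉ L → τ.reg r = σ.reg r

namespace Frame

variable {L L' : List ℕ} {σ τ υ : State}

theorem refl (L : List ℕ) (σ : State) : Frame L σ σ := fun _ _ => rfl

theorem setReg (h : Frame L σ τ) {r : ℕ} (x : ℕ) (hr : r ∈ L := by decide) :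
    Frame L σ (τ.setReg r x) := by
  intro r' hr'
  have hne : r' ≠ r := fun he => hr' (he ▸ hr)
  simp [hne, h r' hr']

theorem setMem (h : Frame L σ τ) (a x : ℕ) : Frame L σ (τ.setMem a x) := h

theorem trans (h : Frame L σ τ) (h' : Frame L' τ υ) (hL : L' ⊆ L := by decide) : Frame L σ υ :=
  fun r hr => (h' r fun hr' => hr (hL hr')).trans (h r hr)

theorem mono (h : Frame L' σ τ) (hL : L' ⊆ L := by decide) : Frame L σ τ :=
  fun r hr => h r fun hr' => hr (hL hr')

end Frame

/-- Multiply register `x` by register `y` as many times as register `lim` says. -/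
def powLoop (x y lim : ℕ) : Program := forUp 18 lim (assign x (.var x * .var y))

/-- Since `b` is positive, the partial products increase, so a bound on the final product is enough
for all of them. -/
theorem Run.powLoop {O : Oracle} {W : ℕ} {σ : State} {Q : State → Prop} {x y lim a b N : ℕ}
    (hx : x < 18) (hy : y < 32) (hl : lim < 32) (hxy : y ≠ x) (hxl : lim ≠ x) (hy' : y ≠ 18)
    (hl' : lim ≠ 18) (ha : σ.reg x = a) (hb : σ.reg y = b) (hN : σ.reg lim = N)
    (hpos : 0 < b) (hW : a * b ^ N < 2 ^ W)
    (hQ : ∀ τ, Frame [x, 18] σ τ → τ.mem = σ.mem → τ.reg x = a * b ^ N → Q τ) :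
    Run O W (powLoop x y lim) σ (N * 31 + 15) Q := by
  have hx' : x ≠ 18 := by omega
  refine Run.forUp (m := 9)
    (Inv := fun j τ => Frame [x, 18] σ τ ∧ τ.mem = σ.mem ∧ τ.reg x = a * b ^ j)
    (by omega) hl hl' hN ⟨(Frame.refl _ _).setReg 0 (by simp), rfl, by simp [hx', ha]⟩ ?_ ?_
  · rintro j τ hj ⟨hf, hm, hv⟩ hj' hlj
    have hy'' : τ.reg y = b := (hf y (by simp [hxy, hy'])).trans hb
    have hv' : (Expr.var x * Expr.var y).eval O τ = a * b ^ (j + 1) := by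
      simp [hv, hy'', pow_succ, mul_assoc]
    refine Run.assign (e := .var x * .var y) ?_ (fun _ => ?_) ?_
    · change (decide (x < 32) && decide (y < 32)) = true
      have : x < 32 := by omega
      simp [this, hy]
    · rw [hv']
      exact lt_of_le_of_lt (Nat.mul_le_mul_left _ (Nat.pow_le_pow_right hpos hj)) hW
    · rw [hv']
      exact ⟨by simp [hx'.symm, hj'], by simp [hxl, hlj],
        (hf.setReg _ (by simp)).setReg _ (by simp), hm, by simp [hx']⟩
  · rintro τ ⟨hf, hm, hv⟩ _ _
    exact hQ τ hf hm hv

/-- For `d = 2 ^ j`, the bit of register `x` with index `j`. -/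
def bitExpr (x d : ℕ) : Expr := .var x / .var d - .var x / .var d / 2 * 2

/-- The machine has no remainder operation: the parity of the quotient `q = s / 2 ^ j` is found as
`q - q / 2 * 2`. -/
theorem eval_bitExpr {O : Oracle} {σ : State} {x d s j : ℕ} (hx : σ.reg x = s)
    (hd : σ.reg d = 2 ^ j) : (bitExpr x d).eval O σ = (s.testBit j).toNat := by
  simp only [bitExpr, Expr.eval_sub, Expr.eval_div, Expr.eval_var, Expr.eval_mul, Expr.eval_two,
    hx, hd, Nat.toNat_testBit]
  omega

theorem closed_bitExpr {x d : ℕ} (hx : x < 32) (hd : d < 32) : (bitExpr x d).Closed = true := by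
  change (decide (x < 32) && decide (d < 32) &&
    (decide (x < 32) && decide (d < 32) && true && true)) = true
  simp [hx, hd]

/-- For the bits of register `10` that are set do `p`; here register `1` is the number of bits,
`u` holds the index of the bit and `d` the power of two. -/
def forBits (u d : ℕ) (p : Program) : Program :=
  .seq (assign d 1) (forUp u 1
    (.seq (cond (bitExpr 10 d) p .skip) (assign d (.var d + .var d))))

/-- The invariant must not depend on the index and the power of two, which the loop itself changes
(`hu`, `hd`). Bits that are not set execute nothing, so `hskip` is a pure implication. -/
theorem Run.forBits {O : Oracle} {W : ℕ} {σ : State} {Q : State → Prop} {u d n s m : ℕ}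
    {p : Program} (Inv : ℕ → State → Prop)
    (hn : σ.reg 1 = n) (hs : σ.reg 10 = s) (hnW : 2 ^ n < 2 ^ W) (hm : 1 ≤ m)
    (hu : ∀ j τ y, Inv j τ → Inv j (τ.setReg u y)) (hd : ∀ j τ y, Inv j τ → Inv j (τ.setReg d y))
    (h0 : Inv 0 σ)
    (hstep : ∀ j τ, j < n → Inv j τ → τ.reg u = j → τ.reg d = 2 ^ j → τ.reg 1 = n →
      τ.reg 10 = s → s.testBit j = true → Run O W p τ m fun τ' => τ'.reg u = j ∧
        τ'.reg d = 2 ^ j ∧ τ'.reg 1 = n ∧ τ'.reg 10 = s ∧ Inv (j + 1) τ')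
    (hskip : ∀ j τ, j < n → Inv j τ → s.testBit j = false → Inv (j + 1) τ)
    (hQ : ∀ τ, Inv n τ → Q τ)
    (hu10 : 10 < u := by decide) (hd10 : 10 < d := by decide) (hu32 : u < 32 := by decide)
    (hd32 : d < 32 := by decide) (hud : u ≠ d := by decide) :
    Run O W (forBits u d p) σ (n * (m + 81) + 19) Q := by
  have h1W : 1 < 2 ^ W := lt_of_le_of_lt Nat.one_le_two_pow hnW
  have hd1 : 1 ≠ d := by omega
  have hu1 : 1 ≠ u := by omega
  have hd10' : 10 ≠ d := by omega
  have hu10' : 10 ≠ u := by omega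
  have hcl : (Expr.var d + Expr.var d).Closed = true := by
    change (decide (d < 32) && decide (d < 32)) = true; simp [hd32]
  refine (Run.seq (Run.assign rfl (fun _ => by simpa using h1W) (Run.forUp (m := m + 59) (N := n)
    (Inv := fun j τ => Inv j τ ∧ τ.reg 10 = s ∧ τ.reg d = 2 ^ j)
    hu32 (by omega) hu1 (by simp [hd1, hn]) ⟨hu _ _ _ (hd _ _ _ h0), by simp [hu10', hd10', hs],
      by simp [hud.symm]⟩ ?_ ?_))).mono (by simp; ring_nf; omega) fun _ _ h => h
  · rintro j τ hj ⟨hI, hτs, hτd⟩ hτu hτn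
    have hbit := eval_bitExpr (O := O) hτs hτd
    have hfin : ∀ τ', τ'.reg u = j → τ'.reg d = 2 ^ j → τ'.reg 1 = n → τ'.reg 10 = s →
        Inv (j + 1) τ' → Run O W (BCFEA.assign d (.var d + .var d)) τ' 9 fun τ' => τ'.reg u = j ∧
          τ'.reg 1 = n ∧ Inv (j + 1) (τ'.setReg u (j + 1)) ∧
          (τ'.setReg u (j + 1)).reg 10 = s ∧ (τ'.setReg u (j + 1)).reg d = 2 ^ (j + 1) := by
      intro τ' h1 h2 h3 h4 h5
      have hv : (Expr.var d + Expr.var d).eval O τ' = 2 ^ (j + 1) := by simp [h2]; ring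
      refine Run.assign (e := .var d + .var d) hcl (fun _ => ?_) ?_
      · rw [hv]
        exact lt_of_le_of_lt (Nat.pow_le_pow_right two_pos hj) hnW
      · rw [hv]
        exact ⟨by simp [hud, h1], by simp [hd1, h3], hu _ _ _ (hd _ _ _ h5),
          by simp [hu10', hd10', h4], by simp [hud.symm]⟩
    refine (Run.seq (m₂ := 9) (Run.cond (m := m) (closed_bitExpr (by omega) hd32) ?_ ?_)).mono
      (by simp [bitExpr]; omega) fun _ _ h => h
    · intro hb
      have hb' : s.testBit j = true := by
        rw [hbit] at hb; simpa using hb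
      exact (hstep j τ hj hI hτu hτd hτn hτs hb').mono le_rfl
        fun τ' _ ⟨h1, h2, h3, h4, h5⟩ => hfin τ' h1 h2 h3 h4 h5
    · intro hb
      have hb' : s.testBit j = false := by
        rw [hbit] at hb; simpa using hb
      exact (Run.skip (hfin τ hτu hτd hτn hτs (hskip j τ hj hI hb'))).mono hm fun _ _ h => h
  · rintro τ ⟨hI, _, _⟩ _ _
    exact hQ τ hI

end BCFEA

/-! ### The algorithm -/

namespace BCFEA

/-- The numbers on which the computation depends: the parameters of the instance, the number of
memory cells taken by the input and their contents, and the values of the utility and cost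
functions, with sets of items given by their characteristic vectors. -/
structure Data where
  n : ℕ
  k : ℕ
  P : ℕ
  B : ℕ
  offset : ℕ
  mem : ℕ → ℕ
  utility : ℕ → ℕ → ℕ
  cost : ℕ → ℕ → ℕ

namespace Data

variable (D : Data)

/-- The number that plays the role of a formal variable. -/
def base : ℕ := 2 ^ (D.n * D.k + 1)

/-- The indicator of `s ∩ {0, …, u - 1}` having no edge to `s`, weighted by cardinality. -/
def weight (s : ℕ) : ℕ → ℕ
  | 0 => 1
  | u + 1 => if s.testBit u then
      if ∃ v < D.n, s.testBit v = true ∧ D.mem (4 + u * D.n + v) ≠ 0 then 0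
      else weight s u * D.base
    else weight s u

/-- The indicator of `s` being a feasible bundle for agent `i`, weighted by cardinality. -/
def value (i s : ℕ) : ℕ :=
  if D.P ≤ D.utility i s ∧ D.cost i s ≤ D.B then D.weight s D.n else 0

end Data

/-- One pass of the fast zeta transform (for addition) or Möbius transform (for subtraction). -/
def pass (o : Op) (j : ℕ) (g : ℕ → ℕ) (s : ℕ) : ℕ :=
  if s.testBit j then o.eval (g s) (g (s - 2 ^ j)) else g s

/-- The first `m` passes of the zeta transform. -/
def zetaPasses (g : ℕ → ℕ) : ℕ → ℕ → ℕ
  | 0 => g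
  | m + 1 => pass .add m (zetaPasses g m)

/-- The first `m` of `n` passes of the Möbius transform, in decreasing order of the indices. -/
def moebiusPasses (n : ℕ) (g : ℕ → ℕ) : ℕ → ℕ → ℕ
  | 0 => g
  | m + 1 => pass .sub (n - (m + 1)) (moebiusPasses n g m)

namespace Data

variable (D : Data)

/-- The product of the zeta transforms for the first `i` agents. -/
def zetaProd (i s : ℕ) : ℕ := ∏ l ∈ Finset.range i, zetaPasses (D.value l) D.n s

/-- The Möbius transform of the product, at the set of all items. -/
def result : ℕ := moebiusPasses D.n (D.zetaProd D.k) D.n (2 ^ D.n - 1)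

/-- All numbers that occur in the computation fit into `W` bits. -/
structure Fits (W : ℕ) : Prop where
  input : 4 + D.n * D.n ≤ D.offset
  address : D.offset + 2 ^ D.n + D.k < 2 ^ W
  number : (2 ^ D.n * D.base ^ D.n) ^ (D.k + 1) * D.base < 2 ^ W

/-- The registers that hold the parameters and the part of the memory that holds the input. -/
structure Ctx (σ : State) : Prop where
  n : σ.reg 1 = D.n
  k : σ.reg 2 = D.k
  P : σ.reg 3 = D.P
  B : σ.reg 4 = D.B
  pow : σ.reg 5 = 2 ^ D.n
  base : σ.reg 6 = D.base
  offset : σ.reg 7 = D.offset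
  offset' : σ.reg 8 = D.offset + 2 ^ D.n
  mem : ∀ a < D.offset, σ.mem a = D.mem a

variable {D}

theorem Ctx.of_frame {L : List ℕ} {σ τ : State} (h : D.Ctx σ) (hf : Frame L σ τ)
    (hm : ∀ a < D.offset, τ.mem a = σ.mem a) (hL : ∀ r ∈ L, 8 < r := by decide) : D.Ctx τ := by
  have key : ∀ r ≤ 8, τ.reg r = σ.reg r := fun r hr => hf r fun hr' => by
    have := hL r hr'; omega
  constructor
  · rw [key 1 (by omega), h.n]
  · rw [key 2 (by omega), h.k]
  · rw [key 3 (by omega), h.P]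
  · rw [key 4 (by omega), h.B]
  · rw [key 5 (by omega), h.pow]
  · rw [key 6 (by omega), h.base]
  · rw [key 7 (by omega), h.offset]
  · rw [key 8 (by omega), h.offset']
  · intro a ha
    rw [hm a ha, h.mem a ha]

/-! ### Bounds on the numbers in the computation -/

theorem base_pos : 0 < D.base := Nat.two_pow_pos _

theorem weight_le (s u : ℕ) : D.weight s u ≤ D.base ^ u := by
  induction u with
  | zero => simp [weight]
  | succ u ih =>
    have h1 : D.base ^ u ≤ D.base ^ (u + 1) := Nat.pow_le_pow_right base_pos (by omega)
    rw [weight]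
    split
    · split
      · exact Nat.zero_le _
      · rw [pow_succ]; exact Nat.mul_le_mul_right _ ih
    · exact ih.trans h1

theorem value_le (i s : ℕ) : D.value i s ≤ D.base ^ D.n := by
  rw [value]
  split
  · exact weight_le s _
  · exact Nat.zero_le _

/-- A pass adds at most one other entry to each entry, so the maximum at most doubles. -/
theorem zetaPasses_le {g : ℕ → ℕ} {X : ℕ} (hg : ∀ s, g s ≤ X) (m s : ℕ) :
    zetaPasses g m s ≤ 2 ^ m * X := by
  induction m generalizing s with
  | zero => simpa [zetaPasses] using hg s
  | succ m ih =>
    have h1 := ih s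
    have h2 := ih (s - 2 ^ m)
    have h3 : 2 ^ (m + 1) * X = 2 ^ m * X + 2 ^ m * X := by ring
    rw [zetaPasses, pass]
    split
    · simp only [Op.eval]; omega
    · omega

theorem moebiusPasses_le {n : ℕ} {g : ℕ → ℕ} {X : ℕ} (hg : ∀ s, g s ≤ X) (m s : ℕ) :
    moebiusPasses n g m s ≤ X := by
  induction m generalizing s with
  | zero => exact hg s
  | succ m ih =>
    rw [moebiusPasses, pass]
    split
    · exact (Nat.sub_le _ _).trans (ih s)
    · exact ih s

theorem zetaProd_le (i s : ℕ) : D.zetaProd i s ≤ (2 ^ D.n * D.base ^ D.n) ^ i := by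
  have := Finset.prod_le_prod' (s := Finset.range i)
    (f := fun l => zetaPasses (D.value l) D.n s) (g := fun _ => 2 ^ D.n * D.base ^ D.n)
    fun l _ => zetaPasses_le (D.value_le l) _ _
  simpa [zetaProd] using this

theorem unit_pos : 0 < 2 ^ D.n * D.base ^ D.n :=
  Nat.mul_pos (Nat.two_pow_pos _) (Nat.pow_pos base_pos)

namespace Fits

variable {W : ℕ}

/-- The spare factor `D.base` leaves room for one more multiplication by the base, as in the weight
of a bundle and in the final modulus. -/
theorem power (h : D.Fits W) {i x : ℕ} (hi : i ≤ D.k + 1) (hx : x ≤ (2 ^ D.n * D.base ^ D.n) ^ i) :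
    x * D.base < 2 ^ W :=
  lt_of_le_of_lt (Nat.mul_le_mul_right _ (hx.trans (Nat.pow_le_pow_right unit_pos hi))) h.number

theorem power' (h : D.Fits W) {i x : ℕ} (hi : i ≤ D.k + 1) (hx : x ≤ (2 ^ D.n * D.base ^ D.n) ^ i) :
    x < 2 ^ W :=
  lt_of_le_of_lt (Nat.le_mul_of_pos_right _ base_pos) (h.power hi hx)

theorem base_pow (h : D.Fits W) {u : ℕ} (hu : u ≤ D.n) : D.base ^ u * D.base < 2 ^ W :=
  h.power (i := 1) (by omega) (by
    rw [pow_one]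
    exact (Nat.pow_le_pow_right base_pos hu).trans (Nat.le_mul_of_pos_left _ (Nat.two_pow_pos _)))

theorem weight (h : D.Fits W) {s u : ℕ} (hu : u ≤ D.n) : D.weight s u * D.base < 2 ^ W :=
  lt_of_le_of_lt (Nat.mul_le_mul_right _ (weight_le s u)) (h.base_pow hu)

end Fits

end Data

/-- Compute the value of the bundle in register `10` for the agent in register `9`, where the
program `V` finds out utility and cost. -/
def valueProg (V : Program) : Program :=
  .seq (assign 14 1) <| .seq (forBits 12 11 <|
    .seq (assign 14 (.var 14 * .var 6)) <| forBits 13 17 <|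
      cond (.mem (4 + .var 12 * .var 1 + .var 13)) (assign 14 0) .skip) <|
  .seq V <| cond ((.var 3 - .var 15) + (.var 16 - .var 4)) (assign 14 0) .skip

/-- The program `V` computes utility and cost of the bundle in register `10` for the agent in
register `9`, in quadratic time. -/
def IsValueProg (O : Oracle) (W : ℕ) (D : Data) (V : Program) : Prop :=
  ∀ ⦃σ : State⦄ ⦃i s : ℕ⦄, D.Ctx σ → i < D.k → s < 2 ^ D.n → σ.reg 9 = i → σ.reg 10 = s →
    Run O W V σ (1000 * (D.n + 1) ^ 2) fun τ => Frame [11, 12, 15, 16] σ τ ∧ τ.mem = σ.mem ∧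
      τ.reg 15 = D.utility i s ∧ τ.reg 16 = D.cost i s

/-! ### The value of one bundle -/

section

variable {O : Oracle} {W : ℕ} {D : Data} {V : Program} {σ : State}

/-- Register `14` is only ever reset to zero, so it keeps its value exactly when no neighbour of `u`
in the bundle is met. -/
theorem run_edgeCheck (hW : D.Fits W) {s u X : ℕ} (hσ : D.Ctx σ) (hs : σ.reg 10 = s)
    (hu : σ.reg 12 = u) (hun : u < D.n) (hX : σ.reg 14 = X) :
    Run O W (forBits 13 17 (cond (.mem (4 + .var 12 * .var 1 + .var 13)) (assign 14 0) .skip))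
      σ (D.n * 123 + 19) fun τ => Frame [13, 14, 17] σ τ ∧ τ.mem = σ.mem ∧
        τ.reg 14 = if ∃ v < D.n, s.testBit v = true ∧ D.mem (4 + u * D.n + v) ≠ 0 then 0
          else X := by
  have hnW : 2 ^ D.n < 2 ^ W := lt_of_le_of_lt (by omega) hW.address
  refine (Run.forBits (n := D.n) (s := s) (m := 42) (Inv := fun j τ => Frame [13, 14, 17] σ τ ∧
      τ.mem = σ.mem ∧
      τ.reg 14 = if ∃ v < j, s.testBit v = true ∧ D.mem (4 + u * D.n + v) ≠ 0 then 0 else X)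
    hσ.n hs hnW (by omega) ?_ ?_ ⟨.refl _ _, rfl, by simpa using hX⟩ ?_ ?_ fun τ h => h)
  · rintro j τ y ⟨h1, h2, h3⟩
    exact ⟨h1.setReg _, h2, by simpa using h3⟩
  · rintro j τ y ⟨h1, h2, h3⟩
    exact ⟨h1.setReg _, h2, by simpa using h3⟩
  · rintro j τ hj ⟨h1, h2, h3⟩ hju hjd hjn hjs hb
    have h12 : τ.reg 12 = u := (h1 12 (by decide)).trans hu
    -- The cell belongs to the adjacency matrix, hence to the input, which the algorithm never
    -- overwrites.
    have hlt : 4 + u * D.n + j < D.offset := by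
      have : (u + 1) * D.n ≤ D.n * D.n := Nat.mul_le_mul_right _ hun
      have := hW.input
      rw [add_mul] at *
      omega
    have hv : (Expr.mem (4 + .var 12 * .var 1 + .var 13)).eval O τ
        = D.mem (4 + u * D.n + j) := by
      simp only [Expr.eval_mem, Expr.eval_add, Expr.eval_mul, Expr.eval_var, Expr.eval_four]
      rw [h12, hjn, hju, h2, hσ.mem _ hlt]
    refine (Run.cond (m := 3) rfl (fun h0 => ?_) fun h0 => ?_).mono
      (by simp) fun _ _ h => h
    · rw [hv] at h0
      refine Run.assign (e := 0) rfl (fun _ => by simp) ?_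
      refine ⟨by simp [hju], by simp [hjd], by simp [hjn], by simp [hjs], h1.setReg _, h2, ?_⟩
      rw [if_pos ⟨j, by omega, hb, h0⟩]; simp
    · rw [hv] at h0
      refine (Run.skip ⟨hju, hjd, hjn, hjs, h1, h2, ?_⟩).mono (by omega) fun _ _ h => h
      rw [h3]
      congr 1
      refine propext ⟨fun ⟨v, hv, h⟩ => ⟨v, by omega, h⟩, fun ⟨v, hv, h⟩ => ⟨v, ?_, h⟩⟩
      rcases Nat.lt_succ_iff_lt_or_eq.1 hv with h' | rfl
      · exact h'
      · exact absurd h0 h.2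
  · rintro j τ hj ⟨h1, h2, h3⟩ hb
    refine ⟨h1, h2, ?_⟩
    rw [h3]
    congr 1
    refine propext ⟨fun ⟨v, hv, h⟩ => ⟨v, by omega, h⟩, fun ⟨v, hv, h⟩ => ⟨v, ?_, h⟩⟩
    rcases Nat.lt_succ_iff_lt_or_eq.1 hv with h' | rfl
    · exact h'
    · simp [hb] at h

theorem run_valueProg (hW : D.Fits W) (hV : IsValueProg O W D V) {i s : ℕ} (hσ : D.Ctx σ)
    (hi : i < D.k) (hs : s < 2 ^ D.n) (hσi : σ.reg 9 = i) (hσs : σ.reg 10 = s) :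
    Run O W (valueProg V) σ (2000 * (D.n + 1) ^ 2) fun τ => Frame [11, 12, 13, 14, 15, 16, 17] σ τ ∧
      τ.mem = σ.mem ∧ τ.reg 14 = D.value i s := by
  have hnW : 2 ^ D.n < 2 ^ W := lt_of_le_of_lt (by omega) hW.address
  have h1W : 1 < 2 ^ W := lt_of_le_of_lt Nat.one_le_two_pow hnW
  refine (Run.seq (m₁ := 4) (Run.assign (e := 1) rfl (fun _ => by simpa using h1W) <|
    Run.seq (m₂ := 1000 * (D.n + 1) ^ 2 + 30) <|
    Run.forBits (n := D.n) (s := s) (m := D.n * 123 + 28)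
      (Inv := fun j τ => Frame [11, 12, 13, 14, 17] σ τ ∧ τ.mem = σ.mem ∧ τ.reg 14 = D.weight s j)
      (by simp [hσ.n]) (by simp [hσs]) hnW (by omega) ?_ ?_
      ⟨(Frame.refl _ _).setReg _, rfl, by simp [Data.weight]⟩ ?_ ?_ ?_)).mono ?_ fun _ _ h => h
  · rintro j τ y ⟨h1, h2, h3⟩
    exact ⟨h1.setReg _, h2, by simpa using h3⟩
  · rintro j τ y ⟨h1, h2, h3⟩
    exact ⟨h1.setReg _, h2, by simpa using h3⟩
  · rintro j τ hj ⟨h1, h2, h3⟩ hju hjd hjn hjs hb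
    have h6 : τ.reg 6 = D.base := (h1 6 (by decide)).trans hσ.base
    refine (Run.seq (m₁ := 9) (Run.assign (e := .var 14 * .var 6) rfl (fun _ => ?_) ?_)).mono
      (m := 9 + (D.n * 123 + 19)) (by omega) fun _ _ h => h
    · simpa [h3, h6] using hW.weight (by omega)
    · have hf : Frame [11, 12, 13, 14, 17] σ
          (τ.setReg 14 ((Expr.var 14 * Expr.var 6).eval O τ)) := h1.setReg _
      refine (run_edgeCheck hW (s := s) (u := j) (X := D.weight s j * D.base)
        (hσ.of_frame hf (fun a _ => by simp [h2])) (by simp [hjs]) (by simp [hju]) hj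
        (by simp [h3, h6])).mono le_rfl fun τ' _ ⟨h1', h2', h3'⟩ => ?_
      refine ⟨?_, ?_, ?_, ?_, hf.trans h1', h2'.trans h2, ?_⟩
      · rw [h1' 12 (by decide)]; simp [hju]
      · rw [h1' 11 (by decide)]; simp [hjd]
      · rw [h1' 1 (by decide)]; simp [hjn]
      · rw [h1' 10 (by decide)]; simp [hjs]
      · rw [h3', Data.weight, if_pos hb]
  · rintro j τ hj ⟨h1, h2, h3⟩ hb
    exact ⟨h1, h2, by simp [Data.weight, hb, h3]⟩
  · rintro τ ⟨h1, h2, h3⟩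
    refine Run.seq ((hV (hσ.of_frame h1 fun a _ => by rw [h2]) hi hs
      ((h1 9 (by decide)).trans hσi) ((h1 10 (by decide)).trans hσs)).mono le_rfl
      fun τ' _ ⟨h1', h2', h3', h4'⟩ => ?_)
    have hf : Frame [11, 12, 13, 14, 15, 16, 17] σ τ' := h1.mono.trans h1'
    have hP : τ'.reg 3 = D.P := (hf 3 (by decide)).trans hσ.P
    have hB : τ'.reg 4 = D.B := (hf 4 (by decide)).trans hσ.B
    have h14 : τ'.reg 14 = D.weight s D.n := (h1' 14 (by decide)).trans h3
    -- Both truncated differences vanish exactly when the utility reaches `P` and the cost stays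
    -- within `B`; one test of their sum checks both conditions.
    have hv : ((Expr.var 3 - .var 15) + (.var 16 - .var 4)).eval O τ'
        = (D.P - D.utility i s) + (D.cost i s - D.B) := by simp [hP, hB, h3', h4']
    refine (Run.cond (m := 3) rfl (fun h0 => ?_) fun h0 => ?_).mono (by simp) fun _ _ h => h
    · rw [hv] at h0
      refine Run.assign (e := 0) rfl (fun _ => by simp) ⟨hf.setReg _, h2'.trans h2, ?_⟩
      rw [Data.value, if_neg (by omega)]; simp
    · rw [hv] at h0
      refine (Run.skip ⟨hf, h2'.trans h2, ?_⟩).mono (by omega) fun _ _ h => h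
      rw [Data.value, if_pos (by omega), h14]
  · nlinarith [Nat.zero_le D.n]

end

end BCFEA

/-! ### The transforms, the loop over the agents and the final test as programs -/

namespace BCFEA

/-- Fill the work array with the values for the agent in register `9`. -/
def fillProg (V : Program) : Program :=
  forUp 10 5 (.seq (valueProg V) (write (.var 8 + .var 10) (.var 14)))

/-- One pass of a transform of the array to whose start register `b` points; register `11` holds
the power of two. -/
def passProg (o : Op) (b : ℕ) : Program :=
  forUp 10 5 (cond (bitExpr 10 11)
    (write (.var b + .var 10) (.op o (.mem (.var b + .var 10)) (.mem (.var b + .var 10 - .var 11))))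
    .skip)

/-- The zeta transform of the work array. -/
def zetaProg : Program :=
  .seq (assign 11 1) (forUp 18 1 (.seq (passProg .add 8) (assign 11 (.var 11 + .var 11))))

/-- Multiply the main array by the work array. -/
def mulProg : Program :=
  forUp 10 5 (write (.var 7 + .var 10) (.mem (.var 7 + .var 10) * .mem (.var 8 + .var 10)))

/-- Fill the main array with ones. -/
def onesProg : Program := forUp 10 5 (write (.var 7 + .var 10) 1)

/-- Compute the product of the zeta transforms over all agents in the main array. -/
def agentsProg (V : Program) : Program :=
  .seq onesProg (forUp 9 2 (.seq (fillProg V) (.seq zetaProg mulProg)))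

/-- The Möbius transform of the main array. -/
def moebiusProg : Program :=
  .seq (assign 11 (.var 5))
    (forUp 18 1 (.seq (assign 11 (.var 11 / 2)) (passProg .sub 7)))

/-- Reduce the last entry of the main array modulo a power of the base. -/
def answerProg : Program :=
  .seq (assign 14 (.var 6)) <| .seq (powLoop 14 6 1) <|
  .seq (assign 15 (.mem (.var 7 + .var 5 - 1))) <|
  cond (.var 15 - .var 15 / .var 14 * .var 14) (assign 0 1) (assign 0 0)

/-- Read the input; the expression `L` is the number of its words. -/
def initProg (L : Expr) : Program :=
  .seq (assign 1 (.mem 0)) <| .seq (assign 2 (.mem 1)) <| .seq (assign 3 (.mem 2)) <|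
  .seq (assign 4 (.mem (.lit 3))) <| .seq (assign 5 1) <| .seq (assign 19 2) <|
  .seq (powLoop 5 19 1) <| .seq (assign 20 (.var 1 * .var 2)) <| .seq (assign 6 2) <|
  .seq (powLoop 6 19 20) <| .seq (assign 7 L) (assign 8 (.var 7 + .var 5))

/-- The whole algorithm. -/
def mainProg (L : Expr) (V : Program) : Program :=
  .seq (initProg L) <| .seq (agentsProg V) <| .seq moebiusProg answerProg

section

variable {O : Oracle} {W : ℕ} {D : Data} {V : Program} {σ : State}

theorem run_fillProg (hW : D.Fits W) (hV : IsValueProg O W D V) {i : ℕ} (hσ : D.Ctx σ)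
    (hi : i < D.k) (hσi : σ.reg 9 = i) :
    Run O W (fillProg V) σ (2 ^ D.n * (2100 * (D.n + 1) ^ 2)) fun τ =>
      Frame [10, 11, 12, 13, 14, 15, 16, 17] σ τ ∧
      (∀ a < D.offset + 2 ^ D.n, τ.mem a = σ.mem a) ∧
      ∀ s < 2 ^ D.n, τ.mem (D.offset + 2 ^ D.n + s) = D.value i s := by
  refine (Run.forUp (N := 2 ^ D.n) (m := 2000 * (D.n + 1) ^ 2 + 12) (Inv := fun j τ =>
    Frame [10, 11, 12, 13, 14, 15, 16, 17] σ τ ∧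
      (∀ a < D.offset + 2 ^ D.n, τ.mem a = σ.mem a) ∧
      ∀ s < j, τ.mem (D.offset + 2 ^ D.n + s) = D.value i s) (by decide) (by decide) (by decide)
      hσ.pow ⟨(Frame.refl _ _).setReg _, by simp, by simp⟩ ?_ fun τ h _ _ => h).mono ?_
      fun _ _ h => h
  · rintro j τ hj ⟨h1, h2, h3⟩ hj10 hj5
    have hc := hσ.of_frame h1 fun a ha => h2 a (by omega)
    refine Run.seq ((run_valueProg hW hV hc hi hj ((h1 9 (by decide)).trans hσi) hj10).mono le_rfl
      fun τ' hb ⟨h1', h2', h3'⟩ => Run.write rfl rfl (fun _ => hb.reg 14) ?_)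
    have hf : Frame [10, 11, 12, 13, 14, 15, 16, 17] σ τ' := h1.trans h1'
    have h8 : τ'.reg 8 = D.offset + 2 ^ D.n := (hf 8 (by decide)).trans hσ.offset'
    have h10 : τ'.reg 10 = j := (h1' 10 (by decide)).trans hj10
    refine ⟨by simp [h10], ?_, (hf.setMem _ _).setReg _, ?_, ?_⟩
    · rw [State.setMem_reg, h1' 5 (by decide), hj5]
    · intro a ha
      have hne : a ≠ D.offset + 2 ^ D.n + j := by omega
      simp [h8, h10, hne, h2', h2 a ha]
    · intro s hs
      by_cases hsj : s = j
      · subst hsj; simp [h8, h10, h3']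
      · have := h3 s (by omega)
        simp [h8, h10, hsj, h2', this]
  · have h1 : 1 ≤ 2 ^ D.n := Nat.one_le_two_pow
    have h2 : 1 ≤ (D.n + 1) ^ 2 := Nat.one_le_pow _ _ (by omega)
    nlinarith

/-- A pass can be done in place. An entry whose mask has bit `j` reads only itself and the entry
with that bit removed, and the latter is left unchanged by the same pass. It therefore does not
matter whether that entry has been visited already. -/
theorem run_passProg {o : Op} {b β j : ℕ} {g : ℕ → ℕ} (hσ : D.Ctx σ) (hb : b < 9)
    (hβ : σ.reg b = β) (hd : σ.reg 11 = 2 ^ j) (hg : ∀ s < 2 ^ D.n, σ.mem (β + s) = g s)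
    (hgW : ∀ s < 2 ^ D.n, pass o j g s < 2 ^ W) :
    Run O W (passProg o b) σ (2 ^ D.n * 150) fun τ => Frame [10] σ τ ∧
      (∀ a, a < β ∨ β + 2 ^ D.n ≤ a → τ.mem a = σ.mem a) ∧
      ∀ s < 2 ^ D.n, τ.mem (β + s) = pass o j g s := by
  refine (Run.forUp (N := 2 ^ D.n) (m := 100) (Inv := fun l τ =>
    Frame [10] σ τ ∧ (∀ a, a < β ∨ β + 2 ^ D.n ≤ a → τ.mem a = σ.mem a) ∧
      ∀ s < 2 ^ D.n, τ.mem (β + s) = if s < l then pass o j g s else g s)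
      (by decide) (by decide) (by decide)
      hσ.pow ⟨(Frame.refl _ _).setReg _, by simp, by simpa using hg⟩ ?_ ?_).mono ?_
      fun _ _ h => h
  · rintro l τ hl ⟨h1, h2, h3⟩ hl10 hl5
    have h11 : τ.reg 11 = 2 ^ j := (h1 11 (by decide)).trans hd
    have hbβ : τ.reg b = β := (h1 b (by simp; omega)).trans hβ
    have hbit := eval_bitExpr (O := O) hl10 h11
    refine (Run.cond (m := 50) rfl (fun h0 => ?_) fun h0 => ?_).mono
      (by simp [bitExpr]) fun _ _ h => h
    · rw [hbit] at h0
      have hlb : l.testBit j = true := by simpa using h0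
      have hle : 2 ^ j ≤ l := Nat.ge_two_pow_of_testBit hlb
      have hva : (Expr.var b + .var 10).eval O τ = β + l := by simp [hbβ, hl10]
      have hv : (Expr.op o (.mem (.var b + .var 10)) (.mem (.var b + .var 10 - .var 11))).eval O τ
          = pass o j g l := by
        have e1 := h3 l hl
        have e2 := h3 (l - 2 ^ j) (by omega)
        have e3 : pass o j g (l - 2 ^ j) = g (l - 2 ^ j) := by
          have : (l - 2 ^ j).testBit j = false := by
            have := Nat.testBit_two_pow_add_eq (l - 2 ^ j) j
            rw [Nat.add_sub_cancel' hle, hlb] at this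
            simpa using this.symm
          simp [pass, this]
        rw [e3, ite_self] at e2
        rw [if_neg (lt_irrefl l)] at e1
        simp only [Expr.eval_op, Expr.eval_mem, Expr.eval_sub, Expr.eval_add, Expr.eval_var,
          hbβ, hl10, h11, Nat.add_sub_assoc hle, e1, e2]
        simp [pass, hlb]
      have hbc : b < 32 := by omega
      refine (Run.write (by simp [Expr.Closed, hbc])
        (by simp [Expr.Closed, HAdd.hAdd, Add.add, HSub.hSub, Sub.sub, hbc])
        (fun _ => by rw [hv]; exact hgW l hl) ?_).mono (by simp) fun _ _ h => h
      rw [hv, hva]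
      refine ⟨by simp [hl10], by simp [hl5], (h1.setMem _ _).setReg _, ?_, ?_⟩
      · intro a ha
        have hne : a ≠ β + l := by omega
        simp [hne, h2 a ha]
      · intro s hs
        by_cases hsl : s = l
        · subst hsl; simp
        · have : s < l + 1 ↔ s < l := by omega
          simp [hsl, h3 s hs, this]
    · rw [hbit] at h0
      have hlb : l.testBit j = false := by simpa using h0
      refine (Run.skip ⟨hl10, hl5, h1.setReg _, h2, ?_⟩).mono (by omega) fun _ _ h => h
      intro s hs
      by_cases hsl : s = l
      · subst hsl; simp [h3 s hs, pass, hlb]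
      · have : s < l + 1 ↔ s < l := by omega
        simp [h3 s hs, this]
  · rintro τ ⟨h1, h2, h3⟩ _ _
    exact ⟨h1, h2, fun s hs => by rw [h3 s hs, if_pos hs]⟩
  · have h1 : 1 ≤ 2 ^ D.n := Nat.one_le_two_pow
    omega

theorem run_zetaProg (hW : D.Fits W) {g : ℕ → ℕ} (hσ : D.Ctx σ)
    (hg : ∀ s < 2 ^ D.n, σ.mem (D.offset + 2 ^ D.n + s) = g s) (hgX : ∀ s, g s ≤ D.base ^ D.n) :
    Run O W zetaProg σ (2 ^ D.n * (300 * (D.n + 1) ^ 2)) fun τ => Frame [10, 11, 18] σ τ ∧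
      (∀ a < D.offset + 2 ^ D.n, τ.mem a = σ.mem a) ∧
      ∀ s < 2 ^ D.n, τ.mem (D.offset + 2 ^ D.n + s) = zetaPasses g D.n s := by
  have hnW : 2 ^ D.n < 2 ^ W := lt_of_le_of_lt (by omega) hW.address
  have h1W : 1 < 2 ^ W := lt_of_le_of_lt Nat.one_le_two_pow hnW
  refine (Run.seq (m₁ := 4) (Run.assign (e := 1) rfl (fun _ => by simpa using h1W) <|
    Run.forUp (N := D.n) (m := 2 ^ D.n * 150 + 9) (Inv := fun j τ =>
      Frame [10, 11, 18] σ τ ∧ (∀ a < D.offset + 2 ^ D.n, τ.mem a = σ.mem a) ∧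
      (∀ s < 2 ^ D.n, τ.mem (D.offset + 2 ^ D.n + s) = zetaPasses g j s) ∧ τ.reg 11 = 2 ^ j)
      (by decide) (by decide) (by decide) (by simp [hσ.n])
      ⟨((Frame.refl _ _).setReg _).setReg _, by simp, by simpa [zetaPasses] using hg, by simp⟩
      ?_ fun τ ⟨h1, h2, h3, _⟩ _ _ => ⟨h1, h2, h3⟩)).mono ?_ fun _ _ h => h
  · rintro j τ hj ⟨h1, h2, h3, h4⟩ hj18 hj1
    have hc := hσ.of_frame h1 fun a ha => h2 a (Nat.lt_add_right _ ha)
    refine Run.seq ((run_passProg hc (by decide) hc.offset' h4 h3 fun s _ => ?_).mono le_rfl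
      fun τ' hb ⟨h1', h2', h3'⟩ => Run.assign (e := .var 11 + .var 11) rfl (fun _ => ?_) ?_)
    · exact hW.power' (i := 1) (by omega) (by
        rw [pow_one]
        exact (Data.zetaPasses_le hgX (j + 1) s).trans
          (Nat.mul_le_mul_right _ (Nat.pow_le_pow_right two_pos hj)))
    · have : (Expr.var 11 + Expr.var 11).eval O τ' = 2 ^ (j + 1) := by
        simp [h1' 11 (by decide), h4]; ring
      rw [this]
      exact lt_of_le_of_lt (Nat.pow_le_pow_right two_pos hj) hnW
    · have h11 : τ'.reg 11 = 2 ^ j := (h1' 11 (by decide)).trans h4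
      refine ⟨?_, ?_, ((h1.trans h1').setReg _).setReg _, ?_, h3', ?_⟩
      · simp [h1' 18 (by decide), hj18]
      · simp [h1' 1 (by decide), hj1]
      · intro a ha
        exact (h2' a (.inl ha)).trans (h2 a ha)
      · simp [h11]; ring
  · have h1 : 1 ≤ 2 ^ D.n := Nat.one_le_two_pow
    have h2 := Nat.mul_le_mul_left D.n h1
    have h3 := Nat.zero_le (2 ^ D.n * D.n ^ 2)
    ring_nf at *
    omega

theorem run_mulProg {g f : ℕ → ℕ} (hσ : D.Ctx σ)
    (hg : ∀ s < 2 ^ D.n, σ.mem (D.offset + s) = g s)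
    (hf : ∀ s < 2 ^ D.n, σ.mem (D.offset + 2 ^ D.n + s) = f s)
    (hgW : ∀ s < 2 ^ D.n, g s * f s < 2 ^ W) :
    Run O W mulProg σ (2 ^ D.n * (100 * (D.n + 1) ^ 2)) fun τ => Frame [10] σ τ ∧
      (∀ a < D.offset, τ.mem a = σ.mem a) ∧
      ∀ s < 2 ^ D.n, τ.mem (D.offset + s) = g s * f s := by
  refine (Run.forUp (N := 2 ^ D.n) (m := 50) (Inv := fun l τ =>
    Frame [10] σ τ ∧ (∀ a, a < D.offset ∨ D.offset + 2 ^ D.n ≤ a → τ.mem a = σ.mem a) ∧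
      ∀ s < 2 ^ D.n, τ.mem (D.offset + s) = if s < l then g s * f s else g s)
      (by decide) (by decide) (by decide)
      hσ.pow ⟨(Frame.refl _ _).setReg _, by simp, by simpa using hg⟩ ?_ ?_).mono ?_
      fun _ _ h => h
  · rintro l τ hl ⟨h1, h2, h3⟩ hl10 hl5
    have h7 : τ.reg 7 = D.offset := (h1 7 (by decide)).trans hσ.offset
    have h8 : τ.reg 8 = D.offset + 2 ^ D.n := (h1 8 (by decide)).trans hσ.offset'
    have hva : (Expr.var 7 + .var 10).eval O τ = D.offset + l := by simp [h7, hl10]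
    have hv : (Expr.mem (.var 7 + .var 10) * .mem (.var 8 + .var 10)).eval O τ = g l * f l := by
      simp [h7, h8, hl10, h3 l hl, h2 (D.offset + 2 ^ D.n + l) (by omega), hf l hl]
    refine (Run.write rfl rfl (fun _ => by rw [hv]; exact hgW l hl) ?_).mono
      (by simp) fun _ _ h => h
    rw [hv, hva]
    refine ⟨by simp [hl10], by simp [hl5], (h1.setMem _ _).setReg _, ?_, ?_⟩
    · intro a ha
      have hne : a ≠ D.offset + l := by omega
      simp [hne, h2 a ha]
    · intro s hs
      by_cases hsl : s = l
      · subst hsl; simp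
      · have : s < l + 1 ↔ s < l := by omega
        simp [hsl, h3 s hs, this]
  · rintro τ ⟨h1, h2, h3⟩ _ _
    exact ⟨h1, fun a ha => h2 a (.inl ha), fun s hs => by rw [h3 s hs, if_pos hs]⟩
  · have h1 : 1 ≤ 2 ^ D.n := Nat.one_le_two_pow
    have h2 : 1 ≤ (D.n + 1) ^ 2 := Nat.one_le_pow _ _ (by omega)
    nlinarith

theorem run_onesProg (hW : D.Fits W) (hσ : D.Ctx σ) :
    Run O W onesProg σ (2 ^ D.n * 100) fun τ => Frame [10] σ τ ∧
      (∀ a < D.offset, τ.mem a = σ.mem a) ∧ ∀ s < 2 ^ D.n, τ.mem (D.offset + s) = 1 := by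
  have h1W : 1 < 2 ^ W :=
    lt_of_le_of_lt (Nat.one_le_two_pow (n := D.n)) (lt_of_le_of_lt (by omega) hW.address)
  refine (Run.forUp (N := 2 ^ D.n) (m := 30) (Inv := fun l τ =>
    Frame [10] σ τ ∧ (∀ a < D.offset, τ.mem a = σ.mem a) ∧ ∀ s < l, τ.mem (D.offset + s) = 1)
      (by decide) (by decide) (by decide)
      hσ.pow ⟨(Frame.refl _ _).setReg _, by simp, by simp⟩ ?_ fun τ h _ _ => h).mono ?_
      fun _ _ h => h
  · rintro l τ hl ⟨h1, h2, h3⟩ hl10 hl5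
    have h7 : τ.reg 7 = D.offset := (h1 7 (by decide)).trans hσ.offset
    have hva : (Expr.var 7 + .var 10).eval O τ = D.offset + l := by simp [h7, hl10]
    refine (Run.write rfl rfl (fun _ => by simpa using h1W) ?_).mono (by simp) fun _ _ h => h
    rw [hva]
    refine ⟨by simp [hl10], by simp [hl5], (h1.setMem _ _).setReg _, ?_, ?_⟩
    · intro a ha
      have hne : a ≠ D.offset + l := by omega
      simp [hne, h2 a ha]
    · intro s hs
      by_cases hsl : s = l
      · subst hsl; simp
      · simp [hsl, h3 s (by omega)]
  · have h1 : 1 ≤ 2 ^ D.n := Nat.one_le_two_pow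
    omega

/-- The main array starts at `D.offset`, directly behind the input, and accumulates the product. The
work array directly behind it is refilled for each agent. -/
theorem run_agentsProg (hW : D.Fits W) (hV : IsValueProg O W D V) (hσ : D.Ctx σ) :
    Run O W (agentsProg V) σ (2 ^ D.n * (3000 * ((D.k + 1) * (D.n + 1) ^ 2))) fun τ =>
      Frame [9, 10, 11, 12, 13, 14, 15, 16, 17, 18] σ τ ∧
      (∀ a < D.offset, τ.mem a = σ.mem a) ∧
      ∀ s < 2 ^ D.n, τ.mem (D.offset + s) = D.zetaProd D.k s := by
  refine (Run.seq ((run_onesProg hW hσ).mono le_rfl fun τ hb ⟨h1, h2, h3⟩ =>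
    Run.forUp (N := D.k) (m := 2 ^ D.n * (2500 * (D.n + 1) ^ 2)) (Inv := fun i τ =>
      Frame [9, 10, 11, 12, 13, 14, 15, 16, 17, 18] σ τ ∧
      (∀ a < D.offset, τ.mem a = σ.mem a) ∧
      ∀ s < 2 ^ D.n, τ.mem (D.offset + s) = D.zetaProd i s)
      (by decide) (by decide) (by decide) ((h1 2 (by decide)).trans hσ.k)
      ⟨h1.mono.setReg _, h2, by simpa [Data.zetaProd] using h3⟩ ?_ fun τ h _ _ => h)).mono ?_
      fun _ _ h => h
  · rintro i τ hi ⟨h1, h2, h3⟩ hi9 hi2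
    have hc := hσ.of_frame h1 h2
    refine (Run.seq ((run_fillProg hW hV hc hi hi9).mono le_rfl fun τ₁ _ ⟨f1, f2, f3⟩ => ?_)).mono
      (m := 2 ^ D.n * (2100 * (D.n + 1) ^ 2) + (2 ^ D.n * (300 * (D.n + 1) ^ 2) +
        2 ^ D.n * (100 * (D.n + 1) ^ 2))) (by ring_nf; omega) fun _ _ h => h
    have c1 := hc.of_frame f1 fun a ha => f2 a (Nat.lt_add_right _ ha)
    refine Run.seq ((run_zetaProg hW c1 f3 (Data.value_le i)).mono le_rfl
      fun τ₂ _ ⟨g1, g2, g3⟩ => ?_)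
    have c2 := c1.of_frame g1 fun a ha => g2 a (Nat.lt_add_right _ ha)
    have e : ∀ s, D.zetaProd i s * zetaPasses (D.value i) D.n s = D.zetaProd (i + 1) s :=
      fun s => (Finset.prod_range_succ _ _).symm
    refine (run_mulProg c2 (g := D.zetaProd i) (fun s hs => ?_) g3 fun s _ => ?_).mono le_rfl
      fun τ₃ _ ⟨p1, p2, p3⟩ => ?_
    · rw [g2 _ (by omega), f2 _ (by omega), h3 s hs]
    · rw [e]
      exact hW.power' (i := i + 1) (by omega) (Data.zetaProd_le _ _)
    · have hf : Frame [10, 11, 12, 13, 14, 15, 16, 17, 18] τ τ₃ := by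
        exact ((Frame.mono f1 : Frame [10, 11, 12, 13, 14, 15, 16, 17, 18] τ τ₁).trans g1).trans p1
      refine ⟨(hf 9 (by decide)).trans hi9, (hf 2 (by decide)).trans hi2,
        (h1.trans hf).setReg _, ?_, ?_⟩
      · intro a ha
        exact (p2 a ha).trans ((g2 a (Nat.lt_add_right _ ha)).trans ((f2 a (Nat.lt_add_right _ ha)).trans (h2 a ha)))
      · intro s hs
        exact (p3 s hs).trans (e s)
  · have h1 : 1 ≤ 2 ^ D.n := Nat.one_le_two_pow
    have h2 : 1 ≤ (D.n + 1) ^ 2 := Nat.one_le_pow _ _ (by omega)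
    have h3 := Nat.mul_le_mul h1 h2
    have h4 := Nat.mul_le_mul_left D.k h3
    have h5 := Nat.mul_le_mul_left (2 ^ D.n) h2
    generalize (D.n + 1) ^ 2 = T at *
    generalize 2 ^ D.n = X at *
    nlinarith

/-- The passes run from the highest bit down, so register `11` starts at `2 ^ n` and is halved
before each pass. Truncated subtraction never enlarges an entry, so the bound on the input array
persists. -/
theorem run_moebiusProg (hW : D.Fits W) {g : ℕ → ℕ} {X : ℕ} (hσ : D.Ctx σ)
    (hg : ∀ s < 2 ^ D.n, σ.mem (D.offset + s) = g s) (hgX : ∀ s, g s ≤ X) (hX : X < 2 ^ W) :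
    Run O W moebiusProg σ (2 ^ D.n * (300 * (D.n + 1) ^ 2)) fun τ => Frame [10, 11, 18] σ τ ∧
      (∀ a < D.offset, τ.mem a = σ.mem a) ∧
      ∀ s < 2 ^ D.n, τ.mem (D.offset + s) = moebiusPasses D.n g D.n s := by
  have hnW : 2 ^ D.n < 2 ^ W := lt_of_le_of_lt (by omega) hW.address
  refine (Run.seq (m₁ := 4) (Run.assign (e := .var 5) rfl (fun _ => by simpa [hσ.pow] using hnW) <|
    Run.forUp (N := D.n) (m := 2 ^ D.n * 150 + 11) (Inv := fun j τ =>
      Frame [10, 11, 18] σ τ ∧ (∀ a < D.offset, τ.mem a = σ.mem a) ∧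
      (∀ s < 2 ^ D.n, τ.mem (D.offset + s) = moebiusPasses D.n g j s) ∧ τ.reg 11 = 2 ^ (D.n - j))
      (by decide) (by decide) (by decide) (by simp [hσ.n])
      ⟨((Frame.refl _ _).setReg _).setReg _, by simp, by simpa [moebiusPasses] using hg,
        by simp [hσ.pow]⟩
      ?_ fun τ ⟨h1, h2, h3, _⟩ _ _ => ⟨h1, h2, h3⟩)).mono ?_ fun _ _ h => h
  · rintro j τ hj ⟨h1, h2, h3, h4⟩ hj18 hj1
    have hv : (Expr.var 11 / 2).eval O τ = 2 ^ (D.n - (j + 1)) := by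
      have : D.n - j = D.n - (j + 1) + 1 := by omega
      simp [h4, this, pow_succ]
    refine (Run.seq (m₁ := 11) (Run.assign (e := .var 11 / 2) rfl (fun _ => ?_) ?_)).mono
      (m := 11 + 2 ^ D.n * 150) (by omega) fun _ _ h => h
    · rw [hv]
      exact lt_of_le_of_lt (Nat.pow_le_pow_right two_pos (by omega)) hnW
    rw [hv]
    have hf : Frame [10, 11, 18] σ (τ.setReg 11 (2 ^ (D.n - (j + 1)))) := h1.setReg _
    have hc := hσ.of_frame hf h2
    refine (run_passProg (j := D.n - (j + 1)) hc (by decide) hc.offset (by simp) h3 fun s _ => ?_).mono le_rfl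
      fun τ' hb ⟨h1', h2', h3'⟩ => ?_
    · exact lt_of_le_of_lt (Data.moebiusPasses_le (n := D.n) hgX (j + 1) s) hX
    · refine ⟨?_, ?_, (hf.trans h1').setReg _, ?_, h3', ?_⟩
      · simp [h1' 18 (by decide), hj18]
      · simp [h1' 1 (by decide), hj1]
      · intro a ha
        exact (h2' a (.inl ha)).trans (h2 a ha)
      · simp [h1' 11 (by decide)]
  · have h1 : 1 ≤ 2 ^ D.n := Nat.one_le_two_pow
    have h2 := Nat.mul_le_mul_left D.n h1
    have h3 := Nat.zero_le (2 ^ D.n * D.n ^ 2)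
    ring_nf at *
    omega

/-- The entry with index `2 ^ n - 1` belongs to the set of all items. Starting the power loop at the
base itself gives the exponent `n + 1`, and the remainder is formed from a quotient. -/
theorem run_answerProg (hW : D.Fits W) (hσ : D.Ctx σ) {x : ℕ}
    (hx : σ.mem (D.offset + (2 ^ D.n - 1)) = x) :
    Run O W answerProg σ (100 * (D.n + 1)) fun τ =>
      τ.reg 0 = if x % D.base ^ (D.n + 1) = 0 then 0 else 1 := by
  have h1W : 1 < 2 ^ W :=
    lt_of_le_of_lt (Nat.one_le_two_pow (n := D.n)) (lt_of_le_of_lt (by omega) hW.address)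
  refine (Run.seq (m₁ := 4) (Run.assign (e := .var 6) rfl (fun hb => hb.reg 6) <|
    Run.seq (Run.powLoop (a := D.base) (b := D.base) (N := D.n) (by decide) (by decide) (by decide)
    (by decide) (by decide) (by decide) (by decide) (by simp [hσ.base]) (by simp [hσ.base])
    (by simp [hσ.n]) Data.base_pos (by rw [mul_comm]; exact hW.base_pow le_rfl)
    fun τ h1 h2 h3 => Run.seq (m₁ := 19) (m₂ := 40)
      (Run.assign (e := .mem (.var 7 + .var 5 - 1)) rfl (fun hb => hb.mem _) ?_)))).mono
    (by omega) fun _ _ h => h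
  have h1X : 1 ≤ 2 ^ D.n := Nat.one_le_two_pow
  have h7 : τ.reg 7 = D.offset := by rw [h1 7 (by decide)]; simp [hσ.offset]
  have h5 : τ.reg 5 = 2 ^ D.n := by rw [h1 5 (by decide)]; simp [hσ.pow]
  have hv : (Expr.mem (.var 7 + .var 5 - 1)).eval O τ = x := by
    simp [h7, h5, h2, Nat.add_sub_assoc h1X, hx]
  rw [hv]
  have hv' : (Expr.var 15 - .var 15 / .var 14 * .var 14).eval O (τ.setReg 15 x)
      = x % D.base ^ (D.n + 1) := by
    simp [h3, ← pow_succ', Nat.mod_eq_sub_div_mul]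
  refine (Run.cond (m := 4) rfl (fun h0 => ?_) fun h0 => ?_).mono (by simp) fun _ _ h => h
  · rw [hv'] at h0
    exact Run.assign (e := 1) rfl (fun _ => by simpa using h1W) (by simp [h0])
  · rw [hv'] at h0
    exact (Run.assign (e := 0) rfl (fun _ => by simp) (by simp [h0])).mono (by simp) fun _ _ h => h

end

end BCFEA

/-! ### Reading the input and the running time of the whole program -/

namespace BCFEA

section

variable {O : Oracle} {W : ℕ} {D : Data} {V : Program} {σ : State} {L : Expr}

/-- The length of the input is not given to the machine. It is computed by `L` from `n` and `k`,
which is why `hL` speaks of all states with the right registers `1` and `2`. -/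
theorem run_initProg (hW : D.Fits W) (hn : σ.mem 0 = D.n) (hk : σ.mem 1 = D.k) (hP : σ.mem 2 = D.P)
    (hB : σ.mem 3 = D.B) (hm : ∀ a < D.offset, σ.mem a = D.mem a) (hc : L.Closed = true)
    (hL : ∀ τ : State, τ.reg 1 = D.n → τ.reg 2 = D.k → L.eval O τ = D.offset) :
    Run O W (initProg L) σ (1000 * ((D.k + 1) * (D.n + 1)) + L.steps) fun τ =>
      D.Ctx τ ∧ τ.mem = σ.mem := by
  have hnW : 2 ^ D.n < 2 ^ W := lt_of_le_of_lt (by omega) hW.address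
  have hoW : D.offset + 2 ^ D.n < 2 ^ W := lt_of_le_of_lt (by omega) hW.address
  have hbW : D.base < 2 ^ W := by simpa using hW.base_pow (Nat.zero_le _)
  have hb2 : 2 * 2 ^ (D.n * D.k) = D.base := by rw [Data.base, pow_succ, mul_comm]
  have hnk : D.n * D.k < 2 ^ W := by
    have := Nat.lt_two_pow_self (n := D.n * D.k)
    omega
  have h2W : 2 < 2 ^ W := by
    have := Nat.one_le_two_pow (n := D.n * D.k)
    omega
  apply Run.mono (Q' := fun τ => D.Ctx τ ∧ τ.mem = σ.mem) _ _ fun _ _ h => h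
  rotate_left
  refine Run.seq <| Run.assign (e := .mem 0) rfl (fun hb => hb.mem _) <|
    Run.seq <| Run.assign (e := .mem 1) rfl (fun hb => hb.mem _) <|
    Run.seq <| Run.assign (e := .mem 2) rfl (fun hb => hb.mem _) <|
    Run.seq <| Run.assign (e := .mem (.lit 3)) rfl (fun hb => hb.mem _) <|
    Run.seq <| Run.assign (e := 1) rfl (fun _ => h2W.le) <|
    Run.seq <| Run.assign (e := 2) rfl (fun _ => h2W) <|
    Run.seq (m₂ := 9 + (5 + (D.n * D.k * 31 + 15 + (L.steps + 2 + 9)))) <| Run.powLoop (a := 1) (b := 2) (N := D.n) (by decide) (by decide) (by decide)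
      (by decide) (by decide) (by decide) (by decide) (by simp) (by simp) (by simp [hn])
      two_pos (by simpa using hnW) fun τ f1 f2 f3 => ?_
  · have r1 : τ.reg 1 = D.n := by rw [f1 1 (by decide)]; simp [hn]
    have r2 : τ.reg 2 = D.k := by rw [f1 2 (by decide)]; simp [hk]
    have r3 : τ.reg 3 = D.P := by rw [f1 3 (by decide)]; simp [hP]
    have r4 : τ.reg 4 = D.B := by rw [f1 4 (by decide)]; simp [hB]
    have r5 : τ.reg 5 = 2 ^ D.n := by rw [f3]; simp
    have r19 : τ.reg 19 = 2 := by rw [f1 19 (by decide)]; simp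
    clear f1 f3
    refine Run.seq <| Run.assign (e := .var 1 * .var 2) rfl
      (fun _ => by simpa [r1, r2] using hnk) <|
      Run.seq <| Run.assign (e := 2) rfl (fun _ => h2W) <|
      Run.seq <| Run.powLoop (a := 2) (b := 2) (N := D.n * D.k) (by decide) (by decide)
      (by decide) (by decide) (by decide) (by decide) (by decide) (by simp) (by simp [r19])
      (by simp [r1, r2]) two_pos (by rwa [hb2]) fun υ g1 g2 g3 => ?_
    have q1 : υ.reg 1 = D.n := by rw [g1 1 (by decide)]; simp [r1]
    have q2 : υ.reg 2 = D.k := by rw [g1 2 (by decide)]; simp [r2]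
    have q3 : υ.reg 3 = D.P := by rw [g1 3 (by decide)]; simp [r3]
    have q4 : υ.reg 4 = D.B := by rw [g1 4 (by decide)]; simp [r4]
    have q5 : υ.reg 5 = 2 ^ D.n := by rw [g1 5 (by decide)]; simp [r5]
    have hv := hL υ q1 q2
    refine Run.seq <| Run.assign hc (fun _ => by rw [hv]; omega) <|
      Run.assign (e := .var 7 + .var 5) rfl (fun _ => by simpa [hv, q5] using hoW) ?_
    have hmem : υ.mem = σ.mem := g2.trans f2
    exact ⟨⟨by simp [q1], by simp [q2], by simp [q3], by simp [q4], by simp [q5],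
      by simp [g3, hb2], by simp [hv], by simp [hv, q5], fun a ha => by simp [hmem, hm a ha]⟩,
      hmem⟩
  · have e : (D.k + 1) * (D.n + 1) = D.n * D.k + D.n + D.k + 1 := by ring
    simp only [Expr.steps, Expr.width, e]
    omega

theorem run_mainProg (hW : D.Fits W) (hV : IsValueProg O W D V) (hn : σ.mem 0 = D.n)
    (hk : σ.mem 1 = D.k) (hP : σ.mem 2 = D.P) (hB : σ.mem 3 = D.B)
    (hm : ∀ a < D.offset, σ.mem a = D.mem a) (hc : L.Closed = true)
    (hL : ∀ τ : State, τ.reg 1 = D.n → τ.reg 2 = D.k → L.eval O τ = D.offset) :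
    Run O W (mainProg L V) σ (2 ^ D.n * ((5000 + L.steps) * ((D.k + 1) * (D.n + 1) ^ 2))) fun τ =>
      τ.reg 0 = if D.result % D.base ^ (D.n + 1) = 0 then 0 else 1 := by
  refine (Run.seq ((run_initProg hW hn hk hP hB hm hc hL).mono le_rfl fun τ₁ _ ⟨c1, _⟩ =>
    Run.seq ((run_agentsProg hW hV c1).mono le_rfl fun τ₂ _ ⟨f2, m2, a2⟩ => ?_))).mono
    (m := 1000 * ((D.k + 1) * (D.n + 1)) + L.steps +
      (2 ^ D.n * (3000 * ((D.k + 1) * (D.n + 1) ^ 2)) +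
        (2 ^ D.n * (300 * (D.n + 1) ^ 2) + 100 * (D.n + 1)))) ?_ fun _ _ h => h
  · have c2 := c1.of_frame f2 m2
    refine Run.seq ((run_moebiusProg hW c2 a2 (Data.zetaProd_le D.k)
      (hW.power' (i := D.k) (by omega) le_rfl)).mono le_rfl fun τ₃ _ ⟨f3, m3, a3⟩ => ?_)
    exact run_answerProg hW (c2.of_frame f3 m3)
      (a3 _ (Nat.sub_lt (Nat.two_pow_pos _) one_pos))
  · obtain ⟨K, hK⟩ : ∃ K, D.k + 1 = K := ⟨_, rfl⟩
    obtain ⟨N, hN⟩ : ∃ N, D.n + 1 = N := ⟨_, rfl⟩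
    obtain ⟨X, hX⟩ : ∃ X, 2 ^ D.n = X := ⟨_, rfl⟩
    -- All terms of the running time are compared with the single product `X * (K * N ^ 2)`, which
    -- dominates because every factor is at least one.
    have hX1 : 1 ≤ X := hX ▸ Nat.one_le_two_pow
    rw [hK, hN, hX]
    have hK1 : 1 ≤ K := by omega
    have hN1 : 1 ≤ N := by omega
    have hNN : N ≤ N ^ 2 := Nat.le_self_pow two_ne_zero N
    have h1 : N ^ 2 ≤ K * N ^ 2 := Nat.le_mul_of_pos_left _ hK1
    have h2 : K * N ≤ K * N ^ 2 := Nat.mul_le_mul_left _ hNN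
    generalize K * N ^ 2 = Y at *
    have h3 : Y ≤ X * Y := Nat.le_mul_of_pos_left _ hX1
    have h4 : X * N ^ 2 ≤ X * Y := Nat.mul_le_mul_left _ h1
    have h5 : L.steps ≤ L.steps * (X * Y) := Nat.le_mul_of_pos_right _ (by omega)
    calc _ = 1000 * (K * N) + L.steps + (3000 * (X * Y) + (300 * (X * N ^ 2) + 100 * N)) := by ring
      _ ≤ 5000 * (X * Y) + L.steps * (X * Y) := by omega
      _ = _ := by ring

end

end BCFEA

/-! ### Correctness -/

namespace BCFEA

/-- The bit being removed is set, so the subtraction borrows nothing from higher bits. -/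
theorem testBit_sub_two_pow {s m : ℕ} (h : s.testBit m = true) (v : ℕ) :
    (s - 2 ^ m).testBit v = (s.testBit v && decide (v ≠ m)) := by
  obtain ⟨r, rfl⟩ := Nat.exists_eq_add_of_le (Nat.ge_two_pow_of_testBit h)
  rw [Nat.add_sub_cancel_left]
  have hr : r.testBit m = false := by simpa [Nat.testBit_two_pow_add_eq] using h
  rcases lt_trichotomy v m with hv | rfl | hv
  · simp [Nat.testBit_two_pow_add_gt hv, hv.ne]
  · simp [hr]
  · obtain ⟨d, rfl⟩ := Nat.exists_eq_add_of_lt hv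
    have e : (2 ^ m + r) / 2 ^ (m + 1) = r / 2 ^ (m + 1) := by
      rw [pow_succ, ← Nat.div_div_eq_div_mul, ← Nat.div_div_eq_div_mul,
        Nat.add_div_left _ (Nat.two_pow_pos m)]
      rw [Nat.testBit_eq_decide_div_mod_eq, decide_eq_false_iff_not] at hr
      omega
    have key : ∀ x : ℕ, x.testBit (m + d + 1) = (x / 2 ^ (m + 1)).testBit d := fun x => by
      rw [Nat.testBit_div_two_pow, show d + (m + 1) = m + d + 1 by ring]
    rw [key, key, e]
    have : m + d + 1 ≠ m := by omega
    simp [this]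

theorem mem_setOfMask {n s : ℕ} {v : Fin n} : v ∈ setOfMask n s ↔ s.testBit v = true := by
  simp [setOfMask]

theorem setOfMask_sub_two_pow {n s : ℕ} {v : Fin n} (h : v ∈ setOfMask n s) :
    setOfMask n (s - 2 ^ (v : ℕ)) = (setOfMask n s).erase v := by
  ext u
  rw [mem_setOfMask, testBit_sub_two_pow (mem_setOfMask.1 h), Finset.mem_erase, mem_setOfMask]
  simp [Fin.ext_iff, and_comm]

theorem setOfMask_two_pow_sub_one (n : ℕ) : setOfMask n (2 ^ n - 1) = Finset.univ := by
  ext v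
  simp [mem_setOfMask, Nat.testBit_two_pow_sub_one]

theorem card_setOfMask (n s : ℕ) :
    (setOfMask n s).card = ((Finset.range n).filter fun v => s.testBit v = true).card := by
  rw [← Finset.card_map Fin.valEmbedding]
  congr 1
  ext v
  simp only [Finset.mem_map, mem_setOfMask, Fin.valEmbedding_apply, Finset.mem_filter,
    Finset.mem_range]
  exact ⟨fun ⟨u, hu, e⟩ => e ▸ ⟨u.2, hu⟩, fun ⟨h, hb⟩ => ⟨⟨v, h⟩, hb, rfl⟩⟩

/-- The entry to be subtracted has bit `j` clear, so it is the one that was added, unchanged. The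
difference is exact, and truncated subtraction does no harm. -/
theorem pass_sub_pass_add (j : ℕ) (g : ℕ → ℕ) : pass .sub j (pass .add j g) = g := by
  ext s
  by_cases h : s.testBit j = true
  · have := testBit_sub_two_pow h j
    simp [pass, h, this, Op.eval]
  · simp [pass, h]

/-- Because the inverse passes come in decreasing order, each meets the zeta pass that was applied
last and cancels it. No commutation of passes is needed. -/
theorem moebiusPasses_zetaPasses (g : ℕ → ℕ) {n j : ℕ} (hj : j ≤ n) :
    moebiusPasses n (zetaPasses g n) j = zetaPasses g (n - j) := by
  induction j with
  | zero => rfl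
  | succ j ih =>
    have e : n - j = n - (j + 1) + 1 := by omega
    rw [moebiusPasses, ih (by omega), e, zetaPasses, pass_sub_pass_add]

/-- The invariant of the fast zeta transform: after the passes for the bits below `m`, exactly the
items below `m` have become optional. -/
theorem zetaPasses_setOfMask {n : ℕ} (g : Finset (Fin n) → ℕ) {m : ℕ} (hm : m ≤ n) (s : ℕ) :
    zetaPasses (fun s => g (setOfMask n s)) m s =
      ∑ Y ∈ (setOfMask n s).powerset with ∀ v ∈ setOfMask n s, v ∉ Y → (v : ℕ) < m, g Y := by
  induction m generalizing s with
  | zero =>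
    rw [zetaPasses, Finset.sum_eq_single_of_mem (setOfMask n s) (by simp +contextual)]
    intro Y hY hne
    simp only [Finset.mem_filter, Finset.mem_powerset, Nat.not_lt_zero, imp_false,
      not_not] at hY
    exact absurd (Finset.Subset.antisymm hY.1 hY.2) hne
  | succ m ih =>
    let u : Fin n := ⟨m, hm⟩
    have hlt : ∀ v : Fin n, (v : ℕ) < m + 1 ↔ (v : ℕ) < m ∨ v = u := fun v => by
      simp [u, Fin.ext_iff]; omega
    rw [zetaPasses, pass]
    split
    · rename_i h
      have hu : u ∈ setOfMask n s := mem_setOfMask.2 h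
      rw [Op.eval, ih (by omega), ih (by omega), setOfMask_sub_two_pow hu]
      generalize setOfMask n s = S at hu ⊢
      -- The subsets that contain `u` come from the old entry at `S`, those that avoid it from the
      -- old entry at `S.erase u`.
      rw [← Finset.sum_filter_add_sum_filter_not
        (S.powerset.filter fun Y => ∀ v ∈ S, v ∉ Y → (v : ℕ) < m + 1) (fun Y => u ∈ Y) g]
      congr 1
      · refine Finset.sum_congr (Finset.ext fun Y => ?_) fun _ _ => rfl
        simp only [Finset.mem_filter, Finset.mem_powerset, hlt]
        constructor
        · rintro ⟨h1, h2⟩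
          refine ⟨⟨h1, fun v hv hY => .inl (h2 v hv hY)⟩, ?_⟩
          by_contra hY
          exact absurd (h2 u hu hY) (lt_irrefl m)
        · rintro ⟨⟨h1, h2⟩, h3⟩
          exact ⟨h1, fun v hv hY => (h2 v hv hY).resolve_right fun e => hY (e ▸ h3)⟩
      · refine Finset.sum_congr (Finset.ext fun Y => ?_) fun _ _ => rfl
        simp only [Finset.mem_filter, Finset.mem_powerset, hlt, Finset.mem_erase,
          Finset.subset_erase]
        constructor
        · rintro ⟨⟨h1, h3⟩, h2⟩
          refine ⟨⟨h1, fun v hv hY => ?_⟩, h3⟩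
          by_cases e : v = u
          · exact .inr e
          · exact .inl (h2 v ⟨e, hv⟩ hY)
        · rintro ⟨⟨h1, h2⟩, h3⟩
          exact ⟨⟨h1, h3⟩, fun v hv hY => (h2 v hv.2 hY).resolve_right hv.1⟩
    · rename_i h
      have hu : u ∉ setOfMask n s := fun h' => h (mem_setOfMask.1 h')
      rw [ih (by omega)]
      refine Finset.sum_congr (Finset.ext fun Y => ?_) fun _ _ => rfl
      simp only [Finset.mem_filter, Finset.mem_powerset, hlt]
      refine and_congr_right fun _ => ⟨fun h v hv hY => .inl (h v hv hY), fun h v hv hY => ?_⟩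
      exact (h v hv hY).resolve_right fun e => hu (e ▸ hv)

theorem zetaPasses_eq_sum_powerset {n : ℕ} (g : Finset (Fin n) → ℕ) (s : ℕ) :
    zetaPasses (fun s => g (setOfMask n s)) n s = ∑ Y ∈ (setOfMask n s).powerset, g Y := by
  rw [zetaPasses_setOfMask g le_rfl, Finset.filter_true_of_mem fun Y _ v _ _ => v.2]

/-- A tuple consists of subsets of a set exactly when its union is a subset of that set. Hence a
product of zeta transforms is the zeta transform of the function `h` below, which the Möbius
transform recovers. Being a sum of natural numbers, `h` stays within the range where truncated
subtraction is exact. -/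
theorem moebiusPasses_prod {n k : ℕ} (f : Fin k → Finset (Fin n) → ℕ) (g : ℕ → ℕ)
    (hg : ∀ s, g s = ∏ i, zetaPasses (fun s => f i (setOfMask n s)) n s) (s : ℕ) :
    moebiusPasses n g n s =
      ∑ S : Fin k → Finset (Fin n) with Finset.univ.biUnion S = setOfMask n s, ∏ i, f i (S i) := by
  let h : Finset (Fin n) → ℕ := fun Y =>
    ∑ S : Fin k → Finset (Fin n) with Finset.univ.biUnion S = Y, ∏ i, f i (S i)
  have e : g = zetaPasses (fun s => h (setOfMask n s)) n := by
    ext s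
    rw [hg, zetaPasses_eq_sum_powerset]
    simp only [zetaPasses_eq_sum_powerset, h]
    -- Expand the product of sums into a sum over tuples and collect the tuples by their union.
    rw [Finset.prod_univ_sum, ← Finset.sum_fiberwise_of_maps_to
      (g := fun S => Finset.univ.biUnion S) (t := (setOfMask n s).powerset)]
    · refine Finset.sum_congr rfl fun Y hY => Finset.sum_congr (Finset.ext fun S => ?_) fun _ _ => rfl
      simp only [Finset.mem_filter, Fintype.mem_piFinset, Finset.mem_powerset, Finset.mem_univ,
        true_and, and_iff_right_iff_imp]
      rintro rfl i
      exact (Finset.subset_biUnion_of_mem S (Finset.mem_univ i)).trans (Finset.mem_powerset.1 hY)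
    · intro S hS
      simp only [Fintype.mem_piFinset, Finset.mem_powerset] at hS
      exact Finset.mem_powerset.2 (Finset.biUnion_subset.2 fun i _ => hS i)
  rw [e, moebiusPasses_zetaPasses _ le_rfl, Nat.sub_self]
  rfl

/-- A cover whose bundles have as many elements in total as the ground set is a partition. -/
theorem disjoint_of_sum_card_le {n k : ℕ} {S : Fin k → Finset (Fin n)}
    (hS : Finset.univ.biUnion S = Finset.univ) (hc : ∑ i, (S i).card ≤ n) {i j : Fin k}
    (hij : i ≠ j) : Disjoint (S i) (S j) := by
  rw [Finset.disjoint_left]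
  intro v hi hj
  -- If `v` lies in two bundles, removing it from one of them leaves a cover of total size below
  -- `n`, which is too small to cover `n` items.
  let T := Function.update S i ((S i).erase v)
  have hT : Finset.univ.biUnion T = Finset.univ := by
    rw [Finset.eq_univ_iff_forall] at hS ⊢
    intro u
    obtain ⟨l, -, hl⟩ := Finset.mem_biUnion.1 (hS u)
    rw [Finset.mem_biUnion]
    by_cases hu : u = v
    · exact ⟨j, Finset.mem_univ _, by simp [T, hij.symm, hu, hj]⟩
    · refine ⟨l, Finset.mem_univ _, ?_⟩
      by_cases hli : l = i
      · subst hli; simp [T, hu, hl]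
      · simp [T, hli, hl]
  have h1 : n ≤ ∑ l, (T l).card := by
    have := Finset.card_biUnion_le (s := Finset.univ) (t := T)
    rwa [hT, Finset.card_univ, Fintype.card_fin] at this
  have h2 : ∑ l, (T l).card < ∑ l, (S l).card := by
    refine Finset.sum_lt_sum (fun l _ => ?_) ⟨i, Finset.mem_univ _, ?_⟩
    · by_cases hli : l = i
      · subst hli; simpa [T] using Finset.card_erase_le
      · simp [T, hli]
    · simpa [T] using Finset.card_erase_lt_of_mem hi
  omega

open Classical in
/-- The weighted number of covers by feasible bundles detects whether there is a partition into
feasible bundles. -/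
theorem sum_covers_mod_eq_zero_iff {n k M : ℕ} (feas : Fin k → Finset (Fin n) → Prop)
    (hM : (2 ^ n) ^ k < M) :
    (∑ S : Fin k → Finset (Fin n) with Finset.univ.biUnion S = Finset.univ,
      ∏ i, if feas i (S i) then M ^ (S i).card else 0) % M ^ (n + 1) = 0 ↔
    ¬ ∃ S : Fin k → Finset (Fin n), Finset.univ.biUnion S = Finset.univ ∧
      (∀ i, feas i (S i)) ∧ ∑ i, (S i).card = n := by
  have hM0 : 0 < M := by omega
  have hprod : ∀ S : Fin k → Finset (Fin n),
      (∏ i, if feas i (S i) then M ^ (S i).card else 0) =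
        if ∀ i, feas i (S i) then M ^ ∑ i, (S i).card else 0 := by
    intro S
    split_ifs with h
    · rw [← Finset.prod_pow_eq_pow_sum]
      exact Finset.prod_congr rfl fun i _ => if_pos (h i)
    · push Not at h
      obtain ⟨i, hi⟩ := h
      exact Finset.prod_eq_zero (Finset.mem_univ i) (if_neg hi)
  let A : Finset (Fin k → Finset (Fin n)) := Finset.univ.filter fun S =>
    Finset.univ.biUnion S = Finset.univ ∧ (∀ i, feas i (S i)) ∧ ∑ i, (S i).card = n
  -- There are only `(2 ^ n) ^ k` tuples in all.
  have hA : A.card < M := by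
    refine lt_of_le_of_lt (Finset.card_le_univ A) ?_
    simpa using hM
  -- A cover has total size at least `n`. If it is larger, the term is divisible by `M ^ (n + 1)`;
  -- if it is equal, a feasible cover contributes exactly `M ^ n`.
  have hmod : (∑ S : Fin k → Finset (Fin n) with Finset.univ.biUnion S = Finset.univ,
      ∏ i, if feas i (S i) then M ^ (S i).card else 0) ≡ A.card * M ^ n [MOD M ^ (n + 1)] := by
    have e : A.card * M ^ n = ∑ S : Fin k → Finset (Fin n) with
        Finset.univ.biUnion S = Finset.univ,
        if (∀ i, feas i (S i)) ∧ ∑ i, (S i).card = n then M ^ n else 0 := by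
      rw [← Finset.sum_filter, Finset.filter_filter, Finset.sum_const, smul_eq_mul]
    rw [e]
    refine Nat.ModEq.sum fun S hS => ?_
    rw [hprod]
    by_cases hf : ∀ i, feas i (S i)
    · by_cases hc : ∑ i, (S i).card = n
      · rw [if_pos hf, if_pos (And.intro hf hc), hc]
      · rw [if_pos hf, if_neg fun h => hc h.2, Nat.modEq_zero_iff_dvd]
        refine pow_dvd_pow _ ?_
        have := Finset.card_biUnion_le (s := Finset.univ) (t := S)
        rw [(Finset.mem_filter.1 hS).2, Finset.card_univ, Fintype.card_fin] at this
        omega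
    · rw [if_neg hf, if_neg fun h => hf h.1]
  -- After cancelling `M ^ n` the claim is that `M` divides the number of partitions only if that
  -- number is zero, which holds because it is less than `M`.
  rw [hmod, ← Nat.dvd_iff_mod_eq_zero, pow_succ', Nat.mul_dvd_mul_iff_right (Nat.pow_pos hM0)]
  constructor
  · rintro hd ⟨S, hS⟩
    have hpos : 0 < A.card := Finset.card_pos.2 ⟨S, Finset.mem_filter.2 ⟨Finset.mem_univ _, hS⟩⟩
    exact absurd (Nat.le_of_dvd hpos hd) (by omega)
  · intro h
    have : A = ∅ := Finset.filter_eq_empty_iff.2 fun S _ hS => h ⟨S, hS⟩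
    simp [this]

/-- A bundle that the agent accepts. -/
structure Instance.IsFeasible (I : Instance) (i : Fin I.k) (S : Finset (Fin I.n)) : Prop where
  indep : I.graph.IsIndepSet (S : Set (Fin I.n))
  budget : I.cost i S ≤ I.B
  satisfied : I.P ≤ I.utility i S

/-- Trades pairwise disjointness for a condition on the total size, the one thing about a cover that
the exponents of `M` record. -/
theorem Instance.isYes_iff (I : Instance) : I.IsYes ↔ ∃ S : Fin I.k → Finset (Fin I.n),
    Finset.univ.biUnion S = Finset.univ ∧ (∀ i, I.IsFeasible i (S i)) ∧
      ∑ i, (S i).card = I.n := by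
  refine exists_congr fun S => ⟨fun h => ?_, fun ⟨h1, h2, h3⟩ => ?_⟩
  · have hu : Finset.univ.biUnion S = Finset.univ :=
      Finset.eq_univ_iff_forall.2 fun v => by simpa using h.cover v
    refine ⟨hu, fun i => ⟨h.indep i, h.budget i, h.satisfied i⟩, ?_⟩
    rw [← Finset.card_biUnion fun i _ j _ hij => h.disjoint i j hij, hu]
    simp
  · refine ⟨fun i j hij => disjoint_of_sum_card_le h1 h3.le hij, fun v => ?_,
      fun i => (h2 i).indep, fun i => (h2 i).budget, fun i => (h2 i).satisfied⟩
    simpa using Finset.eq_univ_iff_forall.1 h1 v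

/-- The computation for an instance whose explicit part takes `L` memory cells with contents
`mem`. -/
def Instance.data (I : Instance) (L : ℕ) (mem : ℕ → ℕ) : Data where
  n := I.n
  k := I.k
  P := I.P
  B := I.B
  offset := L
  mem := mem
  utility := I.oracle .utility
  cost := I.oracle .cost

/-! ### From the instance to the computed number -/

section

variable {I : Instance} {L : ℕ} {mem : ℕ → ℕ}

-- Each chosen item contributes one factor of the base, unless its row of the matrix shows a
-- neighbour in the set. All of the set is searched, not just the smaller items.
open Classical in
theorem weight_eq (hmem : ∀ u v : Fin I.n, mem (4 + u * I.n + v) = if I.graph.Adj u v then 1 else 0)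
    (s : ℕ) {m : ℕ} (hm : m ≤ I.n) : (I.data L mem).weight s m =
      if ∀ u ∈ setOfMask I.n s, (u : ℕ) < m → ∀ v ∈ setOfMask I.n s, ¬ I.graph.Adj u v then
        (I.data L mem).base ^ ((Finset.range m).filter fun v => s.testBit v = true).card else 0 := by
  induction m with
  | zero => simp [Data.weight]
  | succ m ih =>
    let w : Fin I.n := ⟨m, hm⟩
    have hlt : ∀ v : Fin I.n, (v : ℕ) < m + 1 ↔ (v : ℕ) < m ∨ v = w := fun v => by
      simp [w, Fin.ext_iff]; omega
    have hsplit : (∀ u ∈ setOfMask I.n s, (u : ℕ) < m + 1 → ∀ v ∈ setOfMask I.n s,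
        ¬ I.graph.Adj u v) ↔ (∀ u ∈ setOfMask I.n s, (u : ℕ) < m → ∀ v ∈ setOfMask I.n s,
        ¬ I.graph.Adj u v) ∧ (s.testBit m = true → ∀ v ∈ setOfMask I.n s, ¬ I.graph.Adj w v) := by
      constructor
      · intro h
        exact ⟨fun u hu hum => h u hu (by omega), fun hb => h w (mem_setOfMask.2 hb) (by simp [w])⟩
      · rintro ⟨h1, h2⟩ u hu hum
        rcases (hlt u).1 hum with h | rfl
        · exact h1 u hu h
        · exact h2 (mem_setOfMask.1 hu)
    have hex : (∃ v < (I.data L mem).n, s.testBit v = true ∧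
        (I.data L mem).mem (4 + m * (I.data L mem).n + v) ≠ 0) ↔
        ¬ ∀ v ∈ setOfMask I.n s, ¬ I.graph.Adj w v := by
      push Not
      constructor
      · rintro ⟨v, hv, hb, h0⟩
        refine ⟨⟨v, hv⟩, mem_setOfMask.2 hb, ?_⟩
        by_contra hn
        exact h0 ((hmem w ⟨v, hv⟩).trans (if_neg hn))
      · rintro ⟨v, hv, ha⟩
        refine ⟨v, v.2, mem_setOfMask.1 hv, ?_⟩
        exact fun h0 => one_ne_zero (((hmem w v).trans (if_pos ha)).symm.trans h0)
    rw [Data.weight, ih (by omega), Finset.range_add_one, Finset.filter_insert]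
    by_cases hb : s.testBit m = true
    · rw [if_pos hb, if_pos hb, Finset.card_insert_of_notMem (by simp), pow_succ]
      by_cases hw : ∀ v ∈ setOfMask I.n s, ¬ I.graph.Adj w v
      · rw [if_neg fun h => hex.1 h hw, ite_mul, zero_mul]
        exact if_congr (hsplit.trans (and_iff_left fun _ => hw)).symm rfl rfl
      · rw [if_pos (hex.2 hw), if_neg fun h => hw ((hsplit.1 h).2 hb)]
    · rw [if_neg hb, if_neg hb]
      exact if_congr (hsplit.trans (and_iff_left fun h => absurd h hb)).symm rfl rfl

open Classical in
theorem value_eq (hmem : ∀ u v : Fin I.n, mem (4 + u * I.n + v) = if I.graph.Adj u v then 1 else 0)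
    (i : Fin I.k) (s : ℕ) : (I.data L mem).value i s =
      if I.IsFeasible i (setOfMask I.n s) then
        (I.data L mem).base ^ (setOfMask I.n s).card else 0 := by
  have hu : (I.data L mem).utility i s = I.utility i (setOfMask I.n s) := by
    simp [Instance.data, Instance.oracle]
  have hc : (I.data L mem).cost i s = I.cost i (setOfMask I.n s) := by
    simp [Instance.data, Instance.oracle]
  have hi : (∀ u ∈ setOfMask I.n s, (u : ℕ) < I.n → ∀ v ∈ setOfMask I.n s, ¬ I.graph.Adj u v) ↔
      I.graph.IsIndepSet (setOfMask I.n s : Set (Fin I.n)) := by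
    constructor
    · exact fun h u hu v hv _ => h u hu u.2 v hv
    · intro h u hu _ v hv ha
      exact h hu hv ha.ne ha
  have hw := weight_eq (L := L) hmem s le_rfl
  rw [Data.value, hu, hc, show (I.data L mem).n = I.n from rfl, hw, card_setOfMask]
  simp only [hi]
  by_cases h : I.IsFeasible i (setOfMask I.n s)
  · rw [if_pos h, if_pos ⟨h.satisfied, h.budget⟩, if_pos h.indep]
  · rw [if_neg h]
    split_ifs with h1 h2
    · exact absurd ⟨h2, h1.2, h1.1⟩ h
    · rfl
    · rfl

/-- Joins the two halves of the argument. The base `2 ^ (n * k + 1)` exceeds the number `(2 ^ n) ^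
k` of tuples, as the counting lemma demands. -/
theorem result_mod_eq_zero_iff
    (hmem : ∀ u v : Fin I.n, mem (4 + u * I.n + v) = open Classical in
      if I.graph.Adj u v then 1 else 0) :
    (I.data L mem).result % (I.data L mem).base ^ (I.n + 1) = 0 ↔ ¬ I.IsYes := by
  classical
  rw [I.isYes_iff, ← sum_covers_mod_eq_zero_iff (M := (I.data L mem).base)]
  · have h := moebiusPasses_prod (fun i S =>
      if I.IsFeasible i S then (I.data L mem).base ^ S.card else 0) ((I.data L mem).zetaProd I.k)
      (fun s => ?_) (2 ^ I.n - 1)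
    · rw [setOfMask_two_pow_sub_one] at h
      rw [← h]
      rfl
    · rw [Data.zetaProd, ← Fin.prod_univ_eq_prod_range]
      refine Finset.prod_congr rfl fun i _ => ?_
      congr 1
      ext s
      exact value_eq hmem i s
  · rw [Data.base, ← pow_mul]
    exact Nat.pow_lt_pow_right one_lt_two (Nat.lt_succ_self _)

end

end BCFEA

/-! ### Input encoding and running time -/

namespace BCFEA

/-- Turns the nested list into one indexed family, from which length and entries can be read off. -/
theorem tableWords_eq_ofFn {k n : ℕ} (f : Fin k → Fin n → ℕ) :
    tableWords f = List.ofFn fun x : Fin (k * n) => f x.divNat x.modNat := by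
  rw [List.ofFn_mul, tableWords, List.flatMap, List.ofFn_eq_map]
  congr 1
  refine List.map_congr_left fun i _ => ?_
  rw [List.ofFn_eq_map]
  refine List.map_congr_left fun j _ => ?_
  have hn : 0 < n := j.pos
  congr 1 <;> ext
  · simp [Fin.divNat, Nat.mul_comm (i : ℕ), Nat.mul_add_div hn]
  · simp [Fin.modNat, Nat.mul_comm (i : ℕ), Nat.mod_eq_of_lt j.2]

theorem length_tableWords {k n : ℕ} (f : Fin k → Fin n → ℕ) : (tableWords f).length = k * n := by
  rw [tableWords_eq_ofFn, List.length_ofFn]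

theorem index_lt {k n : ℕ} (i : Fin k) (j : Fin n) : (i : ℕ) * n + j < k * n := by
  have := Nat.mul_le_mul_right n (Nat.succ_le_of_lt i.2)
  rw [Nat.succ_mul] at this
  omega

theorem getD_tableWords {k n : ℕ} (f : Fin k → Fin n → ℕ) (i : Fin k) (j : Fin n) :
    (tableWords f).getD (i * n + j) 0 = f i j := by
  have h := index_lt i j
  have hn : 0 < n := j.pos
  rw [List.getD_eq_getElem _ _ (by rwa [length_tableWords])]
  simp only [tableWords_eq_ofFn, List.getElem_ofFn]
  congr 1 <;> ext
  · simp [Fin.divNat, Nat.mul_comm (i : ℕ), Nat.mul_add_div hn]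
  · simp [Fin.modNat, Nat.mul_comm (i : ℕ), Nat.mod_eq_of_lt j.2]

open Classical in
theorem adjWords_eq {n : ℕ} (G : SimpleGraph (Fin n)) :
    adjWords G = tableWords fun u v => if G.Adj u v then 1 else 0 := rfl

theorem length_adjWords {n : ℕ} (G : SimpleGraph (Fin n)) : (adjWords G).length = n * n := by
  rw [adjWords_eq, length_tableWords]

open Classical in
theorem getD_words_adj {n : ℕ} (G : SimpleGraph (Fin n)) (a b c d : ℕ) (l : List ℕ) (u v : Fin n) :
    ([a, b, c, d] ++ (adjWords G ++ l)).getD (4 + u * n + v) 0 = if G.Adj u v then 1 else 0 := by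
  have h := index_lt u v
  rw [add_assoc, List.getD_append_right _ _ _ _ (by simp), List.length_cons, List.length_cons,
    List.length_cons, List.length_cons, List.length_nil]
  rw [show 4 + ((u : ℕ) * n + v) - (0 + 1 + 1 + 1 + 1) = u * n + v by omega,
    List.getD_append _ _ _ _ (by rwa [length_adjWords]), adjWords_eq, getD_tableWords]

theorem size_le_binaryLength {w : List ℕ} {x : ℕ} (h : x ∈ w) : Nat.size x ≤ binaryLength w := by
  have := List.single_le_sum (l := w.map fun x => Nat.size x + 1) (by simp) _
    (List.mem_map_of_mem h)
  rw [binaryLength]; omega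

theorem length_le_binaryLength (w : List ℕ) : w.length ≤ binaryLength w := by
  induction w with
  | nil => simp
  | cons x w ih => simp only [binaryLength, List.map_cons, List.sum_cons, List.length_cons] at *; omega

/-- A bound for the bit lengths of all numbers in the computation for an instance of size `N`. -/
def wordLength (N : ℕ) : ℕ := (N + (N * N + 1) * N) * (N + 1) + N * N + 2 * N + 3

open Polynomial in
/-- The polynomial factor of the running time. -/
noncomputable def timePoly (c : ℕ) : ℕ[X] :=
  C c * ((X + 1) * (X + 1) ^ 2) * ((X + (X * X + 1) * X) * (X + 1) + X * X + 2 * X + 3 + 1)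

theorem eval_timePoly (c N : ℕ) :
    (timePoly c).eval N = c * ((N + 1) * (N + 1) ^ 2) * (wordLength N + 1) := by
  simp [timePoly, wordLength]

/-- All factors are powers of two, so the bound on the numbers is a comparison of exponents,
monotone in `n` and `k`. The address bound needs only `N + 2` bits. -/
theorem Instance.fits_data (I : Instance) {L N : ℕ} {mem : ℕ → ℕ} (hn : I.n ≤ N) (hk : I.k ≤ N)
    (hL : L ≤ N) (hL' : 4 + I.n * I.n ≤ L) : (I.data L mem).Fits (wordLength N) := by
  refine ⟨hL', ?_, ?_⟩
  · change L + 2 ^ I.n + I.k < _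
    have h1 : 2 ^ I.n ≤ 2 ^ N := Nat.pow_le_pow_right two_pos hn
    have h2 : N < 2 ^ N := Nat.lt_two_pow_self
    have h3 : 2 ^ (N + 2) ≤ 2 ^ wordLength N :=
      Nat.pow_le_pow_right two_pos (by rw [wordLength]; omega)
    rw [pow_add] at h3
    omega
  · change (2 ^ I.n * (2 ^ (I.n * I.k + 1)) ^ I.n) ^ (I.k + 1) * 2 ^ (I.n * I.k + 1) < _
    rw [← pow_mul, ← pow_add, ← pow_mul, ← pow_add]
    refine Nat.pow_lt_pow_right one_lt_two ?_
    have : (I.n + (I.n * I.k + 1) * I.n) * (I.k + 1) + (I.n * I.k + 1) ≤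
      (N + (N * N + 1) * N) * (N + 1) + (N * N + 1) := by gcongr
    rw [wordLength]
    omega

/-- The common core of both parts: what remains for each is the layout of the input, a bound on its
entries and on the oracle answers, and the fragment `V`. -/
theorem decides_mainProg (I : Instance) {O : Oracle} {w : List ℕ} {L : Expr} {V : Program} {N : ℕ}
    (hn : I.n ≤ N) (hk : I.k ≤ N) (hw : w.length ≤ N) (hw' : 4 + I.n * I.n ≤ w.length)
    (hx : ∀ x ∈ w, Nat.size x ≤ N) (hO : ∀ q i s, O q i s < 2 ^ wordLength N)
    (hV : IsValueProg O (wordLength N) (I.data w.length fun a => w.getD a 0) V)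
    (h0 : w.getD 0 0 = I.n) (h1 : w.getD 1 0 = I.k) (h2 : w.getD 2 0 = I.P) (h3 : w.getD 3 0 = I.B)
    (hadj : ∀ u v : Fin I.n, w.getD (4 + u * I.n + v) 0 = open Classical in
      if I.graph.Adj u v then 1 else 0)
    (hc : L.Closed = true)
    (hL : ∀ τ : State, τ.reg 1 = I.n → τ.reg 2 = I.k → L.eval O τ = w.length) :
    Decides (mainProg L V) O w I.IsYes (2 ^ I.n * (timePoly (5000 + L.steps)).eval N) := by
  have hb : Bounded (wordLength N) (State.init w) := by
    refine ⟨fun r => Nat.two_pow_pos _, fun a => ?_⟩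
    change w.getD a 0 < _
    by_cases ha : a < w.length
    · rw [List.getD_eq_getElem _ _ ha]
      refine lt_of_lt_of_le (Nat.size_le.1 (hx _ (List.getElem_mem ha))) ?_
      exact Nat.pow_le_pow_right two_pos (by rw [wordLength]; omega)
    · rw [List.getD_eq_default _ _ (by omega)]
      exact Nat.two_pow_pos _
  obtain ⟨τ', τ, t, he, ht, hs, -, hq⟩ := run_mainProg (σ := State.init w)
    (I.fits_data hn hk hw hw') hV h0 h1 h2 h3 (fun _ _ => rfl) hc hL hO hb _ (Sim.refl _)
  have hres := result_mod_eq_zero_iff (I := I) (L := w.length) (mem := fun a => w.getD a 0) hadj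
  change τ.reg 0 = if (I.data w.length fun a => w.getD a 0).result %
    (I.data w.length fun a => w.getD a 0).base ^ (I.n + 1) = 0 then 0 else 1 at hq
  rw [← hs.reg 0 (by omega)] at hq
  refine ⟨τ', t, he, ht.trans ?_, fun h => ?_, fun h => ?_⟩
  · change 2 ^ I.n * ((5000 + L.steps) * ((I.k + 1) * (I.n + 1) ^ 2)) * _ ≤ _
    rw [eval_timePoly, mul_assoc]
    gcongr
  · rw [hq, if_neg fun h' => hres.1 h' h]
  · rw [hq, if_pos (hres.2 h)]

/-! ### Value oracles -/

theorem Instance.size_oracle_le (I : Instance) (q : QueryKind) (i s : ℕ) :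
    Nat.size (I.oracle q i s) ≤ I.size := by
  have key : ∀ i : Fin I.k, max (Nat.size (I.utility i (setOfMask I.n s)))
      (Nat.size (I.cost i (setOfMask I.n s))) ≤ I.size := fun i =>
    (Finset.le_sup (f := fun x : Fin I.k × Finset (Fin I.n) =>
      max (Nat.size (I.utility x.1 x.2)) (Nat.size (I.cost x.1 x.2)))
      (Finset.mem_univ (i, setOfMask I.n s))).trans (Nat.le_add_left _ _)
  cases q <;> rw [oracle] <;> split
  · exact (le_max_left _ _).trans (key _)
  · simp
  · exact (le_max_right _ _).trans (key _)
  · simp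

/-- Ask for the utility and the cost. -/
def oracleValueProg : Program :=
  .seq (assign 15 (.ask .utility (.var 9) (.var 10))) (assign 16 (.ask .cost (.var 9) (.var 10)))

theorem isValueProg_oracleValueProg {I : Instance} {L W : ℕ} {mem : ℕ → ℕ} :
    IsValueProg I.oracle W (I.data L mem) oracleValueProg := by
  intro σ i s _ _ _ hσi hσs
  refine Run.intro fun hO _ => ?_
  refine (Run.seq (m₁ := 9) (m₂ := 9) <|
    Run.assign (e := .ask .utility (.var 9) (.var 10)) rfl (fun _ => hO _ _ _) <|
    Run.assign (e := .ask .cost (.var 9) (.var 10)) rfl (fun _ => hO _ _ _)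
      ⟨((Frame.refl _ _).setReg _).setReg _, rfl, ?_, ?_⟩).mono ?_ fun _ _ h => h
  · have : 1 ≤ ((I.data L mem).n + 1) ^ 2 := Nat.one_le_pow _ _ (by omega)
    omega
  · simp [hσi, hσs]; rfl
  · simp [hσi, hσs]; rfl

theorem exists_program_oracle : ∃ (p : Program) (q : Polynomial ℕ), ∀ I : Instance, 1 ≤ I.k →
    Decides p I.oracle I.words I.IsYes (2 ^ I.n * q.eval I.size) := by
  refine ⟨mainProg (4 + .var 1 * .var 1) oracleValueProg,
    timePoly (5000 + (4 + .var 1 * .var 1 : Expr).steps), fun I _ => ?_⟩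
  have hlen : I.words.length = 4 + I.n * I.n := by
    simp [Instance.words, length_adjWords]; ring
  have hN : binaryLength I.words + I.k ≤ I.size := by rw [Instance.size]; omega
  have hl := length_le_binaryLength I.words
  have hn := Nat.le_mul_self I.n
  refine decides_mainProg I (by omega) (by omega) (by omega) hlen.ge
    (fun x hx => (size_le_binaryLength hx).trans (by omega))
    (fun q i s => lt_of_lt_of_le (Nat.size_le.1 (I.size_oracle_le q i s))
      (Nat.pow_le_pow_right two_pos (by rw [wordLength]; omega)))
    isValueProg_oracleValueProg rfl rfl rfl rfl (fun u v => ?_) rfl fun τ h1 _ => ?_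
  · have := getD_words_adj I.graph I.n I.k I.P I.B [] u v
    rwa [List.append_nil] at this
  · simp [h1, hlen]

/-! ### Additive functions -/

/-- Add up the utilities and costs of the items in the bundle. -/
def additiveValueProg : Program :=
  .seq (assign 15 0) <| .seq (assign 16 0) <| forBits 12 11 <|
    .seq (assign 15 (.var 15 + .mem (4 + .var 1 * .var 1 + .var 9 * .var 1 + .var 12)))
      (assign 16 (.var 16 +
        .mem (4 + .var 1 * .var 1 + .var 2 * .var 1 + .var 9 * .var 1 + .var 12)))

/-- The sum of the entries of a row of a table in the memory that are selected by a bit mask. -/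
def maskedSum (mem : ℕ → ℕ) (a s m : ℕ) : ℕ :=
  ∑ v ∈ Finset.range m, if s.testBit v = true then mem (a + v) else 0

theorem maskedSum_le {mem : ℕ → ℕ} {X : ℕ} (h : ∀ a, mem a ≤ X) (a s m : ℕ) :
    maskedSum mem a s m ≤ m * X := by
  have := Finset.sum_le_card_nsmul (Finset.range m)
    (fun v => if s.testBit v = true then mem (a + v) else 0) X fun v _ => by
      split
      · exact h _
      · exact Nat.zero_le _
  simpa [maskedSum] using this

theorem maskedSum_succ_of_testBit {mem : ℕ → ℕ} {a s m : ℕ} (h : s.testBit m = true) :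
    maskedSum mem a s (m + 1) = maskedSum mem a s m + mem (a + m) := by
  rw [maskedSum, Finset.sum_range_succ, if_pos h, maskedSum]

theorem maskedSum_succ_of_not_testBit {mem : ℕ → ℕ} {a s m : ℕ} (h : s.testBit m = false) :
    maskedSum mem a s (m + 1) = maskedSum mem a s m := by
  rw [maskedSum, Finset.sum_range_succ, if_neg (by simp [h]), add_zero, maskedSum]

theorem sum_setOfMask {n : ℕ} {mem : ℕ → ℕ} {a : ℕ} (f : Fin n → ℕ)
    (h : ∀ v : Fin n, mem (a + v) = f v) (s : ℕ) :
    ∑ v ∈ setOfMask n s, f v = maskedSum mem a s n := by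
  rw [maskedSum, ← Fin.sum_univ_eq_sum_range (fun v => if s.testBit v = true then mem (a + v) else 0),
    setOfMask, Finset.sum_filter]
  simp only [h]

/-- The rows of the two tables lie behind the adjacency matrix at fixed distances. A partial sum has
at most `D.n` terms, each at most `X`, hence the bound `hXW`. -/
theorem isValueProg_additiveValueProg {O : Oracle} {W X : ℕ} {D : Data} (hW : D.Fits W)
    (hX : ∀ a, D.mem a ≤ X) (hXW : D.n * X < 2 ^ W)
    (hoff : D.offset = 4 + D.n * D.n + D.k * D.n + D.k * D.n)
    (hu : ∀ i < D.k, ∀ s < 2 ^ D.n, D.utility i s =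
      maskedSum D.mem (4 + D.n * D.n + i * D.n) s D.n)
    (hc : ∀ i < D.k, ∀ s < 2 ^ D.n, D.cost i s =
      maskedSum D.mem (4 + D.n * D.n + D.k * D.n + i * D.n) s D.n) :
    IsValueProg O W D additiveValueProg := by
  intro σ i s hσ hi hs hσi hσs
  have hnW : 2 ^ D.n < 2 ^ W := lt_of_le_of_lt (by omega) hW.address
  have hsum : ∀ a, ∀ m ≤ D.n, maskedSum D.mem a s m < 2 ^ W := fun a m hm =>
    lt_of_le_of_lt ((maskedSum_le hX a s m).trans (Nat.mul_le_mul_right _ hm)) hXW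
  refine (Run.seq (m₁ := 3) <| Run.assign (e := 0) rfl (fun _ => Nat.two_pow_pos _) <|
    Run.seq (m₁ := 3) <| Run.assign (e := 0) rfl (fun _ => Nat.two_pow_pos _) <|
    Run.forBits (n := D.n) (s := s) (m := 200) (Inv := fun j τ =>
      Frame [11, 12, 15, 16] σ τ ∧ τ.mem = σ.mem ∧
      τ.reg 15 = maskedSum D.mem (4 + D.n * D.n + i * D.n) s j ∧
      τ.reg 16 = maskedSum D.mem (4 + D.n * D.n + D.k * D.n + i * D.n) s j)
    (by simp [hσ.n]) (by simp [hσs]) hnW (by omega) ?_ ?_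
    ⟨((Frame.refl _ _).setReg _).setReg _, rfl, by simp [maskedSum], by simp [maskedSum]⟩
    ?_ ?_ ?_).mono ?_ fun _ _ h => h
  · rintro j τ y ⟨h1, h2, h3, h4⟩
    exact ⟨h1.setReg _, h2, by simpa using h3, by simpa using h4⟩
  · rintro j τ y ⟨h1, h2, h3, h4⟩
    exact ⟨h1.setReg _, h2, by simpa using h3, by simpa using h4⟩
  · rintro j τ hj ⟨h1, h2, h3, h4⟩ hju hjd hjn hjs hb
    have hτi : τ.reg 9 = i := (h1 9 (by decide)).trans hσi
    have hτk : τ.reg 2 = D.k := (h1 2 (by decide)).trans hσ.k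
    have hlt : i * D.n + j < D.k * D.n := index_lt (⟨i, hi⟩ : Fin D.k) (⟨j, hj⟩ : Fin D.n)
    have hv : (Expr.var 15 + .mem (4 + .var 1 * .var 1 + .var 9 * .var 1 + .var 12)).eval O τ =
        maskedSum D.mem (4 + D.n * D.n + i * D.n) s (j + 1) := by
      rw [maskedSum_succ_of_testBit hb, ← hσ.mem _ (by omega)]
      simp [h3, hjn, hτi, hju, h2]
    refine (Run.seq (m₂ := 100) <| Run.assign
      (e := .var 15 + .mem (4 + .var 1 * .var 1 + .var 9 * .var 1 + .var 12)) rfl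
      (fun _ => by rw [hv]; exact hsum _ _ hj) ?_).mono (m' := 200) (by decide) fun _ _ h => h
    rw [hv]
    have hv' : (Expr.var 16 + .mem (4 + .var 1 * .var 1 + .var 2 * .var 1 + .var 9 * .var 1 +
        .var 12)).eval O (τ.setReg 15 (maskedSum D.mem (4 + D.n * D.n + i * D.n) s (j + 1))) =
        maskedSum D.mem (4 + D.n * D.n + D.k * D.n + i * D.n) s (j + 1) := by
      rw [maskedSum_succ_of_testBit (a := 4 + D.n * D.n + D.k * D.n + i * D.n) hb,
        ← hσ.mem _ (by omega)]
      simp [h4, hjn, hτi, hτk, hju, h2]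
    refine (Run.assign (e := .var 16 + .mem (4 + .var 1 * .var 1 + .var 2 * .var 1 +
      .var 9 * .var 1 + .var 12)) rfl (fun _ => by rw [hv']; exact hsum _ _ hj) ?_).mono
      (m' := 100) (by decide) fun _ _ h => h
    rw [hv']
    exact ⟨by simp [hju], by simp [hjd], by simp [hjn], by simp [hjs],
      (h1.setReg _).setReg _, h2, by simp, by simp⟩
  · rintro j τ hj ⟨h1, h2, h3, h4⟩ hb
    rw [← maskedSum_succ_of_not_testBit hb] at h3 h4
    exact ⟨h1, h2, h3, h4⟩
  · rintro τ ⟨h1, h2, h3, h4⟩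
    exact ⟨h1, h2, h3.trans (hu i hi s hs).symm, h4.trans (hc i hi s hs).symm⟩
  · nlinarith [Nat.zero_le D.n]

theorem exists_program_additive : ∃ (p : Program) (q : Polynomial ℕ), ∀ I : AdditiveInstance,
    1 ≤ I.k → Decides p noOracle I.words I.toInstance.IsYes (2 ^ I.n * q.eval I.size) := by
  refine ⟨mainProg (4 + .var 1 * .var 1 + .var 2 * .var 1 + .var 2 * .var 1) additiveValueProg,
    timePoly (5000 + (4 + .var 1 * .var 1 + .var 2 * .var 1 + .var 2 * .var 1 : Expr).steps),
    fun I _ => ?_⟩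
  have hlen : I.words.length = 4 + I.n * I.n + I.k * I.n + I.k * I.n := by
    simp [AdditiveInstance.words, length_adjWords, length_tableWords]; ring
  have hN : binaryLength I.words + I.k = I.size := by rw [AdditiveInstance.size]; omega
  have hl := length_le_binaryLength I.words
  have hn := Nat.le_mul_self I.n
  have hx : ∀ x ∈ I.words, Nat.size x ≤ I.size := fun x hx =>
    (size_le_binaryLength hx).trans (by omega)
  have hgetu : ∀ (i : Fin I.k) (v : Fin I.n),
      I.words.getD (4 + I.n * I.n + i * I.n + v) 0 = I.utility i v := by
    intro i v
    have h := index_lt i v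
    have e : 4 + I.n * I.n + i * I.n + v - ([I.n, I.k, I.P, I.B] ++ adjWords I.graph).length =
        i * I.n + v := by simp [length_adjWords]; omega
    rw [AdditiveInstance.words, List.append_assoc, List.getD_append_right _ _ _ _
      (by simp [length_adjWords]; omega), e, List.getD_append _ _ _ _
      (by rwa [length_tableWords]), getD_tableWords]
  have hgetc : ∀ (i : Fin I.k) (v : Fin I.n),
      I.words.getD (4 + I.n * I.n + I.k * I.n + i * I.n + v) 0 = I.cost i v := by
    intro i v
    have e : 4 + I.n * I.n + I.k * I.n + i * I.n + v -
        ([I.n, I.k, I.P, I.B] ++ adjWords I.graph ++ tableWords I.utility).length =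
        i * I.n + v := by simp [length_adjWords, length_tableWords]; omega
    rw [AdditiveInstance.words, List.getD_append_right _ _ _ _
      (by simp [length_adjWords, length_tableWords]; omega), e, getD_tableWords]
  have hfits := I.toInstance.fits_data (L := I.words.length) (N := I.size)
    (mem := fun a => I.words.getD a 0) (show I.n ≤ I.size by omega) (show I.k ≤ I.size by omega)
    (by omega) (show 4 + I.n * I.n ≤ _ by omega)
  have hX : ∀ a, I.words.getD a 0 ≤ 2 ^ I.size := by
    intro a
    by_cases ha : a < I.words.length
    · rw [List.getD_eq_getElem _ _ ha]
      exact (Nat.size_le.1 (hx _ (List.getElem_mem ha))).le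
    · rw [List.getD_eq_default _ _ (by omega)]
      exact Nat.zero_le _
  -- Each entry has at most `I.size` bits, and summing `n` of them costs at most `n` more bits.
  have hXW : I.n * 2 ^ I.size < 2 ^ wordLength I.size := by
    calc I.n * 2 ^ I.size < 2 ^ I.n * 2 ^ I.size :=
          Nat.mul_lt_mul_of_pos_right Nat.lt_two_pow_self (Nat.two_pow_pos _)
      _ = 2 ^ (I.n + I.size) := (pow_add _ _ _).symm
      _ ≤ _ := Nat.pow_le_pow_right two_pos (by rw [wordLength]; omega)
  refine decides_mainProg I.toInstance (show I.n ≤ I.size by omega) (show I.k ≤ I.size by omega)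
    (by omega) (show 4 + I.n * I.n ≤ _ by omega) hx (fun _ _ _ => Nat.two_pow_pos _)
    (isValueProg_additiveValueProg hfits hX hXW hlen (fun i hi s _ => ?_) (fun i hi s _ => ?_))
    rfl rfl rfl rfl (fun u v => ?_) rfl fun τ h1 h2 => ?_
  · change I.toInstance.oracle .utility i s = _
    rw [Instance.oracle, dif_pos (show i < I.toInstance.k from hi)]
    exact sum_setOfMask _ (fun v => hgetu ⟨i, hi⟩ v) s
  · change I.toInstance.oracle .cost i s = _
    rw [Instance.oracle, dif_pos (show i < I.toInstance.k from hi)]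
    exact sum_setOfMask _ (fun v => hgetc ⟨i, hi⟩ v) s
  · have := getD_words_adj I.graph I.n I.k I.P I.B (tableWords I.utility ++ tableWords I.cost) u v
    rw [AdditiveInstance.words, List.append_assoc, List.append_assoc]
    exact this
  · simp only [Expr.eval_add, Expr.eval_mul, Expr.eval_var, Expr.eval_four, h1, h2, hlen]
    rfl

end BCFEA

theorem mainTheorem5 :
    (∃ (p : BCFEA.Program) (q : Polynomial ℕ), ∀ I : BCFEA.Instance, 1 ≤ I.k →
      BCFEA.Decides p I.oracle I.words I.IsYes (2 ^ I.n * q.eval I.size)) ∧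
    (∃ (p : BCFEA.Program) (q : Polynomial ℕ), ∀ I : BCFEA.AdditiveInstance, 1 ≤ I.k →
      BCFEA.Decides p BCFEA.noOracle I.words I.toInstance.IsYes
        (2 ^ I.n * q.eval I.size)) :=
  ⟨BCFEA.exists_program_oracle, BCFEA.exists_program_additive⟩
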